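/- Let $k$ be a field and let $\alpha=(\alpha_0,\alpha_1,\alpha_2,\dots)$ be a sequence of elements of $k$. A commutative Frobenius algebra in a symmetric monoidal category $\mathcal C$ is a commutative algebra object $(A,m,\iota)$ together with a morphism $\varepsilon:A\to\mathbf 1$ such that the pairing $b=\varepsilon\circ m:A\otimes A\to\mathbf 1$ is non-degenerate, i.e. there is a morphism $c:\mathbf 1\to A\otimes A$ such that $b$ and $c$ satisfy the axioms of evaluation and coevaluation maps. Let $\Delta:A\to A\otimes A$ be the comultiplication dual to $m$, that is, $\Delta=(m\otimes\mathrm{id}_A)\circ(\mathrm{id}_A\otimes c)$, and let $x=m\circ\Delta:A\to A$ be the handle endomorphism. If $L$ is a field and $\mathcal C$ is an $L$-linear symmetric monoidal category for which the canonical map $L\to\mathrm{End}(\mathbf 1)$ is an isomorphism, then the evaluation of $A$ is the sequence of elements $a_n\in L$ determined by $\varepsilon\circ x^n\circ\iota=a_n\,\mathrm{id}_{\mathbf 1}$, $n\ge 0$. A finite realization of $\alpha$ consists of a field extension $L$ of $k$ (not necessarily finite), an $L$-linear symmetric monoidal category $\mathcal C$ for which the canonical map $L\to\mathrm{End}(\mathbf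 1)$ is an isomorphism and all of whose $\mathrm{Hom}$ spaces are finite-dimensional over $L$, and a commutative Frobenius algebra $A$ in $\mathcal C$ whose evaluation is $\alpha$ (viewed as a sequence in $L$). The sequence $\alpha$ is (eventually) linearly recurrent if there are integers $d,N\ge 0$ and $c_0,\dots,c_{d-1}\in k$ such that $\alpha_{n+d}=\sum_{i=0}^{d-1}c_i\,\alpha_{n+i}$ for all $n\ge N$. **Theorem 3.1.** The sequence $\alpha$ admits a finite realization if and only if it is linearly recurrent. -/

import Mathlib

open CategoryTheory MonoidalCategory MonObj

universe u w v₁ u₁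

/-- A sequence is *(eventually, homogeneously) linearly recurrent* if, after deleting finitely many
of its terms, it satisfies a homogeneous linear recurrence relation of some order with constant
coefficients. Order `0` is allowed, and says that the sequence is eventually zero. -/
def IsRecurrent {k : Type*} [Field k] (α : ℕ → k) : Prop :=
  ∃ (E : LinearRecurrence k) (N : ℕ), E.IsSolution (fun n => α (N + n))

/-- A Frobenius structure on a monoid object `A` of a monoidal category: a morphism `ε : A ⟶ 𝟙_ C`
such that the pairing `b : A ⊗ A ⟶ A ⟶ 𝟙_ C` (multiplication followed by `ε`) is non-degenerate,
i.e. `b` is the evaluation of an exact pairing of `A` with itself. The coevaluation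
`c : 𝟙_ C ⟶ A ⊗ A` is kept as data; it is determined by `b`. -/
structure FrobeniusStructure {C : Type*} [Category C] [MonoidalCategory C] (A : C) [MonObj A] where
  /-- The counit (trace form) `ε`. -/
  counit : A ⟶ 𝟙_ C
  /-- The exact pairing (evaluation and coevaluation, with the zigzag identities). -/
  exactPairing : ExactPairing A A
  evaluation_eq : exactPairing.evaluation = μ[A] ≫ counit

namespace FrobeniusStructure

variable {C : Type*} [Category C] [MonoidalCategory C] {A : C} [MonObj A]

/-- The comultiplication `Δ : A ⟶ A ⊗ A`, dual to the multiplication under the self-duality of `A`.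
In terms of the copairing `c : 𝟙_ C ⟶ A ⊗ A` it is `a ↦ a · c`: insert `c` on the right, then
multiply the two left-hand factors. -/
def comul (F : FrobeniusStructure A) : A ⟶ A ⊗ A :=
  (ρ_ A).inv ≫ A ◁ F.exactPairing.coevaluation ≫ (α_ A A A).inv ≫ μ[A] ▷ A

/-- The handle endomorphism `x : A ⟶ A ⊗ A ⟶ A`: comultiplication followed by multiplication. -/
def handle (F : FrobeniusStructure A) : End A :=
  F.comul ≫ μ[A]

/-- The morphism `a_n : 𝟙_ C ⟶ 𝟙_ C` attached to the closed surface of genus `n`: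
the unit, then `n` iterations of the handle endomorphism, then the counit. -/
def closed (F : FrobeniusStructure A) (n : ℕ) : 𝟙_ C ⟶ 𝟙_ C :=
  η[A] ≫ (F.handle ^ n : End A) ≫ F.counit

end FrobeniusStructure

/-- A *realization* of a sequence `α` of elements of a field `k`: a commutative Frobenius algebra
`A` in an `L`-linear symmetric monoidal category `C` with `End(𝟙_ C) = L`, for some field extension
`L` of `k`, such that the evaluation of `A` is `α`. -/
structure Realization {k : Type u} [Field k] (α : ℕ → k) where
  /-- The extension field. -/
  L : Type w
  [field : Field L]
  [algebra : Algebra k L]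
  /-- The `L`-linear symmetric monoidal category. -/
  C : Type u₁
  [category : Category.{v₁} C]
  [preadditive : Preadditive C]
  [linear : Linear L C]
  [monoidal : MonoidalCategory C]
  [symmetric : SymmetricCategory C]
  [monoidalPreadditive : MonoidalPreadditive C]
  [monoidalLinear : MonoidalLinear L C]
  /-- The canonical map `L → End(𝟙_ C)` is an isomorphism. -/
  unit_bijective : Function.Bijective (fun r : L => r • 𝟙 (𝟙_ C))
  /-- The commutative Frobenius algebra. -/
  A : C
  [mon : MonObj A]
  [comm : IsCommMonObj A]
  /-- The Frobenius structure on `A`. -/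
  frobenius : FrobeniusStructure A
  /-- The evaluation of `A` is `α`. -/
  evaluation : ∀ n : ℕ, frobenius.closed n = algebraMap k L (α n) • 𝟙 (𝟙_ C)

attribute [instance] Realization.field Realization.algebra Realization.category
  Realization.preadditive Realization.linear Realization.monoidal

/-- A realization is *finite* if all Hom spaces of its category are finite-dimensional over `L`. -/
def Realization.IsFinite {k : Type*} [Field k] {α : ℕ → k} (R : Realization α) : Prop :=
  ∀ X Y : R.C, FiniteDimensional R.L (X ⟶ Y)

/-- The sequence `α` admits a finite realization. The universe levels are those of `k`, of the
extension field `L`, and of the morphisms and the objects of the category. -/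
def AdmitsFiniteRealization {k : Type u} [Field k] (α : ℕ → k) : Prop :=
  ∃ R : Realization.{u, w, v₁, u₁} α, R.IsFinite

-- Necessity. In a finite realization `End A` is a finite-dimensional algebra, so the handle is a
-- root of a monic polynomial over `L`. Multiplying by powers of the handle and closing up with unit
-- and counit gives a recurrence for `α` with coefficients in `L`. A `k`-linear retraction `L → k`
-- of the inclusion moves the coefficients into `k`; it fixes the terms of `α`, and the leading
-- coefficient is `1`.
--
-- Sufficiency. The category wanted is that of linearized two-dimensional cobordisms, with the
-- closed surface of genus `n` evaluated to `α n`, modulo negligible morphisms. A recurrence of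
-- order `d` for `α` then holds for the handles on any component of any cobordism, since closing up
-- only shifts the genus. So each Hom space is spanned by the finitely many partitions of the
-- boundary circles with fewer than `d` handles on each block (`quot_cob_recurrence`,
-- `finiteDimensional_hom`).
--
-- Cobordisms are not handled topologically but through their state sums in the Frobenius algebras
-- `ℚ^S`, for `S` a finite set with nonzero weights. In such an algebra the handle acts by the
-- weights, and the surface of genus `n` evaluates to the sum of the `(n - 1)`-st powers of the
-- weights. A single `S` would impose relations among closed surfaces, so all `S` with weights in
-- `1, 2, 3, …` are used at once. No nonzero polynomial vanishes on all the resulting power sums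
-- (`eq_zero_of_eval_powerSum`), so the endomorphisms of the unit form a polynomial ring `Λ` over
-- `ℤ` with a free variable for every genus (`unitEquiv`). Sending these variables to the terms of
-- `α` is therefore legitimate in any characteristic. A further variable for each element of `L`
-- makes `Λ → L` surjective, so that the quotient by negligible morphisms is `L`-linear with
-- `End(𝟙_) = L`.

universe v

/-! ### Quotients of linear symmetric monoidal subcategories by negligible morphisms -/

section Subquotient

variable (Λ : Type*) [CommRing Λ] (D : Type*) [Category.{v} D] [Preadditive D] [Linear Λ D]
  [MonoidalCategory D] [SymmetricCategory D]

/-- A family of submodules of the Hom modules of a linear symmetric monoidal category that forms a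
wide symmetric monoidal subcategory. -/
structure MonoidalSubmodule where
  /-- The morphisms of the subcategory. -/
  hom (X Y : D) : Submodule Λ (X ⟶ Y)
  id_mem (X : D) : 𝟙 X ∈ hom X X
  comp_mem {X Y Z : D} {f : X ⟶ Y} {g : Y ⟶ Z} : f ∈ hom X Y → g ∈ hom Y Z → f ≫ g ∈ hom X Z
  whiskerLeft_mem (X : D) {Y Z : D} {f : Y ⟶ Z} : f ∈ hom Y Z → X ◁ f ∈ hom (X ⊗ Y) (X ⊗ Z)
  whiskerRight_mem {Y Z : D} {f : Y ⟶ Z} (X : D) : f ∈ hom Y Z → f ▷ X ∈ hom (Y ⊗ X) (Z ⊗ X)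
  associator_hom_mem (X Y Z : D) : (α_ X Y Z).hom ∈ hom _ _
  associator_inv_mem (X Y Z : D) : (α_ X Y Z).inv ∈ hom _ _
  leftUnitor_hom_mem (X : D) : (λ_ X).hom ∈ hom _ _
  leftUnitor_inv_mem (X : D) : (λ_ X).inv ∈ hom _ _
  rightUnitor_hom_mem (X : D) : (ρ_ X).hom ∈ hom _ _
  rightUnitor_inv_mem (X : D) : (ρ_ X).inv ∈ hom _ _
  braiding_hom_mem (X Y : D) : (β_ X Y).hom ∈ hom _ _

/-- An evaluation of the endomorphisms of the unit object of a wide symmetric monoidal subcategory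
in a field, which is a quotient of the base ring. -/
structure MonoidalSubmodule.Evaluation {Λ : Type*} [CommRing Λ] {D : Type*} [Category.{v} D]
    [Preadditive D] [Linear Λ D] [MonoidalCategory D] [SymmetricCategory D]
    (N : MonoidalSubmodule Λ D) (K : Type*) [Field K] [Algebra Λ K] where
  /-- The evaluation. -/
  toFun : N.hom (𝟙_ D) (𝟙_ D) →ₗ[Λ] K
  map_one : toFun ⟨𝟙 _, N.id_mem _⟩ = 1
  -- Together with `surjective`, this keeps the endomorphisms of the unit from exceeding `K` in the
  -- quotient.
  exists_smul : ∀ f ∈ N.hom (𝟙_ D) (𝟙_ D), ∃ r : Λ, f = r • 𝟙 _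
  surjective : Function.Surjective (algebraMap Λ K)

end Subquotient

namespace MonoidalSubmodule

variable {Λ : Type*} [CommRing Λ] {D : Type*} [Category.{v} D] [Preadditive D] [Linear Λ D]
  [MonoidalCategory D] [SymmetricCategory D] {N : MonoidalSubmodule Λ D}
  {K : Type*} [Field K] [Algebra Λ K]

lemma context_mem {X Y : D} {f : X ⟶ Y} (hf : f ∈ N.hom X Y) {U : D}
    {a : 𝟙_ D ⟶ X ⊗ U} (ha : a ∈ N.hom _ _) {b : Y ⊗ U ⟶ 𝟙_ D} (hb : b ∈ N.hom _ _) :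
    a ≫ f ▷ U ≫ b ∈ N.hom _ _ :=
  N.comp_mem ha (N.comp_mem (N.whiskerRight_mem U hf) hb)

variable [MonoidalPreadditive D] [MonoidalLinear Λ D]

namespace Evaluation

/-- A morphism is negligible if every closed morphism that contains it evaluates to zero. -/
def negligible (τ : N.Evaluation K) (X Y : D) : Submodule Λ (N.hom X Y) where
  carrier := {f | ∀ (U : D) (a : 𝟙_ D ⟶ X ⊗ U) (ha : a ∈ N.hom _ _) (b : Y ⊗ U ⟶ 𝟙_ D)
    (hb : b ∈ N.hom _ _), τ.toFun ⟨a ≫ f.1 ▷ U ≫ b, context_mem f.2 ha hb⟩ = 0}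
  add_mem' {f g} hf hg U a ha b hb := by
    have := congrArg₂ (· + ·) (hf U a ha b hb) (hg U a ha b hb)
    simp only [← map_add, add_zero] at this
    simpa using this
  zero_mem' U a ha b hb := by
    have : (⟨a ≫ (0 : X ⟶ Y) ▷ U ≫ b, context_mem (zero_mem _) ha hb⟩ : N.hom _ _) = 0 := by
      ext; simp
    exact (congrArg τ.toFun this).trans (map_zero _)
  smul_mem' r f hf U a ha b hb := by
    have := congrArg (r • ·) (hf U a ha b hb)
    simp only [← map_smul, smul_zero] at this
    simpa using this

variable (τ : N.Evaluation K)

omit [MonoidalPreadditive D] [MonoidalLinear Λ D] in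
lemma toFun_congr {f g : 𝟙_ D ⟶ 𝟙_ D} {hf : f ∈ N.hom _ _} (h : f = g)
    (h0 : ∀ hg : g ∈ N.hom _ _, τ.toFun ⟨g, hg⟩ = 0) : τ.toFun ⟨f, hf⟩ = 0 := by
  subst h; exact h0 _

/-- Whatever is composed with `f` can be absorbed into the closing morphisms `a` and `b`. -/
lemma comp_mem_left {X Y Z : D} {f : N.hom X Y} (hf : f ∈ τ.negligible X Y) (g : N.hom Y Z) :
    (⟨f.1 ≫ g.1, N.comp_mem f.2 g.2⟩ : N.hom X Z) ∈ τ.negligible X Z := fun U a ha b hb =>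
  τ.toFun_congr (by simp) fun _ =>
    hf U a ha (g.1 ▷ U ≫ b) (N.comp_mem (N.whiskerRight_mem U g.2) hb)

lemma comp_mem_right {X Y Z : D} (f : N.hom X Y) {g : N.hom Y Z} (hg : g ∈ τ.negligible Y Z) :
    (⟨f.1 ≫ g.1, N.comp_mem f.2 g.2⟩ : N.hom X Z) ∈ τ.negligible X Z := fun U a ha b hb =>
  τ.toFun_congr (g := (a ≫ f.1 ▷ U) ≫ g.1 ▷ U ≫ b) (by simp) fun _ =>
    hg U _ (N.comp_mem ha (N.whiskerRight_mem U f.2)) b hb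

/-- The extra factor `Z` is absorbed into the auxiliary object: a context for `f ▷ Z` with `U` is a
context for `f` with `Z ⊗ U`. -/
lemma whiskerRight_mem {X Y : D} {f : N.hom X Y} (hf : f ∈ τ.negligible X Y) (Z : D) :
    (⟨f.1 ▷ Z, N.whiskerRight_mem Z f.2⟩ : N.hom _ _) ∈ τ.negligible (X ⊗ Z) (Y ⊗ Z) :=
  fun U a ha b hb =>
    τ.toFun_congr (g := (a ≫ (α_ _ _ _).hom) ≫ f.1 ▷ (Z ⊗ U) ≫ (α_ _ _ _).inv ≫ b) (by simp)
      fun _ => hf (Z ⊗ U) _ (N.comp_mem ha (N.associator_hom_mem _ _ _)) _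
        (N.comp_mem (N.associator_inv_mem _ _ _) hb)

lemma whiskerLeft_mem (Z : D) {X Y : D} {f : N.hom X Y} (hf : f ∈ τ.negligible X Y) :
    (⟨Z ◁ f.1, N.whiskerLeft_mem Z f.2⟩ : N.hom _ _) ∈ τ.negligible (Z ⊗ X) (Z ⊗ Y) := by
  have h := τ.comp_mem_left (τ.comp_mem_right ⟨_, N.braiding_hom_mem Z X⟩ (τ.whiskerRight_mem hf Z))
    ⟨_, N.braiding_hom_mem Y Z⟩
  convert h using 2
  simp

end Evaluation

/-- The quotient of a wide symmetric monoidal subcategory by its negligible morphisms. -/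
structure Subquotient (τ : N.Evaluation K) where
  /-- The underlying object. -/
  obj : D

namespace Subquotient

variable {τ : N.Evaluation K}

/-- The type of morphisms. -/
abbrev Hom (τ : N.Evaluation K) (X Y : D) := N.hom X Y ⧸ τ.negligible X Y

/-- The class of a morphism. -/
def cls (τ : N.Evaluation K) {X Y : D} (f : N.hom X Y) : Hom τ X Y := Submodule.Quotient.mk f

lemma cls_eq_cls {X Y : D} {f g : N.hom X Y} : cls τ f = cls τ g ↔ f - g ∈ τ.negligible X Y :=
  Submodule.Quotient.eq _

/-- Composition. -/
def comp {X Y Z : D} (f : Hom τ X Y) (g : Hom τ Y Z) : Hom τ X Z :=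
  Quotient.liftOn₂ f g (fun f g => cls τ ⟨f.1 ≫ g.1, N.comp_mem f.2 g.2⟩) (by
    intro f g f' g' hf hg
    rw [← Quotient.eq_iff_equiv] at hf hg
    have h := add_mem (τ.comp_mem_left (cls_eq_cls.1 hf) g) (τ.comp_mem_right f' (cls_eq_cls.1 hg))
    rw [cls_eq_cls]
    convert h using 1
    ext
    simp)

/-- Left whiskering. -/
def whiskerLeft (Z : D) {X Y : D} (f : Hom τ X Y) : Hom τ (Z ⊗ X) (Z ⊗ Y) :=
  Quotient.liftOn f (fun f => cls τ ⟨Z ◁ f.1, N.whiskerLeft_mem Z f.2⟩) (by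
    intro f f' hf
    rw [← Quotient.eq_iff_equiv] at hf
    have h := τ.whiskerLeft_mem Z (cls_eq_cls.1 hf)
    rw [cls_eq_cls]
    convert h using 1
    exact Subtype.ext ((tensorLeft Z).map_sub (f := f.1) (g := f'.1)).symm)

/-- Right whiskering. -/
def whiskerRight {X Y : D} (f : Hom τ X Y) (Z : D) : Hom τ (X ⊗ Z) (Y ⊗ Z) :=
  Quotient.liftOn f (fun f => cls τ ⟨f.1 ▷ Z, N.whiskerRight_mem Z f.2⟩) (by
    intro f f' hf
    rw [← Quotient.eq_iff_equiv] at hf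
    have h := τ.whiskerRight_mem (cls_eq_cls.1 hf) Z
    rw [cls_eq_cls]
    convert h using 1
    exact Subtype.ext ((tensorRight Z).map_sub (f := f.1) (g := f'.1)).symm)

instance : Category.{v} (Subquotient τ) where
  Hom X Y := Hom τ X.obj Y.obj
  id X := cls τ ⟨𝟙 X.obj, N.id_mem _⟩
  comp := comp
  id_comp := by rintro X Y ⟨f⟩; exact congrArg (cls τ) (Subtype.ext (Category.id_comp f.1))
  comp_id := by rintro X Y ⟨f⟩; exact congrArg (cls τ) (Subtype.ext (Category.comp_id f.1))
  assoc := by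
    rintro W X Y Z ⟨f⟩ ⟨g⟩ ⟨h⟩
    exact congrArg (cls τ) (Subtype.ext (Category.assoc f.1 g.1 h.1))

/-- The class of a morphism of the subcategory. -/
def quot (τ : N.Evaluation K) {X Y : D} (f : X ⟶ Y) (hf : f ∈ N.hom X Y) : (⟨X⟩ : Subquotient τ) ⟶ ⟨Y⟩ :=
  cls τ ⟨f, hf⟩

lemma quot_comp {X Y Z : D} (f : X ⟶ Y) (hf : f ∈ N.hom X Y) (g : Y ⟶ Z) (hg : g ∈ N.hom Y Z) :
    quot τ f hf ≫ quot τ g hg = quot τ (f ≫ g) (N.comp_mem hf hg) := rfl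

/-- The class of an isomorphism of the subcategory. -/
@[simps]
def quotIso (τ : N.Evaluation K) {X Y : D} (e : X ≅ Y) (h : e.hom ∈ N.hom X Y)
    (h' : e.inv ∈ N.hom Y X) : (⟨X⟩ : Subquotient τ) ≅ ⟨Y⟩ where
  hom := quot τ e.hom h
  inv := quot τ e.inv h'
  hom_inv_id := congrArg (cls τ) (Subtype.ext e.hom_inv_id)
  inv_hom_id := congrArg (cls τ) (Subtype.ext e.inv_hom_id)

instance : Preadditive (Subquotient τ) where
  homGroup X Y := inferInstanceAs (AddCommGroup (Hom τ X.obj Y.obj))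
  add_comp := by
    rintro X Y Z ⟨f⟩ ⟨g⟩ ⟨h⟩
    exact congrArg (cls τ) (Subtype.ext (Preadditive.add_comp _ _ _ f.1 g.1 h.1))
  comp_add := by
    rintro X Y Z ⟨f⟩ ⟨g⟩ ⟨h⟩
    exact congrArg (cls τ) (Subtype.ext (Preadditive.comp_add _ _ _ f.1 g.1 h.1))

/-- The reason why the action of `Λ` on the quotient factors through `K`. -/
lemma smul_mem_negligible {r : Λ} (hr : algebraMap Λ K r = 0) {X Y : D} (f : N.hom X Y) :
    r • f ∈ τ.negligible X Y := fun U a ha b hb => by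
  refine τ.toFun_congr (g := r • (a ≫ f.1 ▷ U ≫ b)) (by simp) fun _ => ?_
  have := map_smul τ.toFun r ⟨_, context_mem f.2 ha hb⟩
  rw [Algebra.smul_def, hr, zero_mul] at this
  exact this

/-- The choice of a preimage is harmless: two preimages differ by an element of the kernel, which
acts by zero. -/
noncomputable instance (X Y : D) : SMul K (Hom τ X Y) :=
  ⟨fun c f => (τ.surjective c).choose • f⟩

lemma smul_cls (c : K) {X Y : D} (f : N.hom X Y) :
    c • cls τ f = cls τ ((τ.surjective c).choose • f) := rfl

lemma algebraMap_smul_cls (r : Λ) {X Y : D} (f : N.hom X Y) :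
    algebraMap Λ K r • cls τ f = cls τ (r • f) := by
  rw [smul_cls, cls_eq_cls, ← sub_smul]
  apply smul_mem_negligible
  rw [map_sub, (τ.surjective (algebraMap Λ K r)).choose_spec, sub_self]

noncomputable instance homModule (X Y : D) : Module K (Hom τ X Y) :=
  Function.Surjective.moduleLeft (algebraMap Λ K) τ.surjective
    fun r f => Quotient.inductionOn f fun f => algebraMap_smul_cls r f

noncomputable instance : Linear K (Subquotient τ) where
  homModule X Y := inferInstanceAs (Module K (Hom τ X.obj Y.obj))
  smul_comp := by
    rintro X Y Z c ⟨f⟩ ⟨g⟩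
    obtain ⟨r, rfl⟩ := τ.surjective c
    refine (congrArg (comp · _) (algebraMap_smul_cls r f)).trans
      (Eq.trans ?_ (algebraMap_smul_cls r _).symm)
    exact congrArg (cls τ) (Subtype.ext (Linear.smul_comp _ _ _ _ f.1 g.1))
  comp_smul := by
    rintro X Y Z ⟨f⟩ c ⟨g⟩
    obtain ⟨r, rfl⟩ := τ.surjective c
    refine (congrArg (comp _ ·) (algebraMap_smul_cls r g)).trans
      (Eq.trans ?_ (algebraMap_smul_cls r _).symm)
    exact congrArg (cls τ) (Subtype.ext (Linear.comp_smul _ _ _ f.1 _ g.1))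

lemma algebraMap_smul_quot (r : Λ) {X Y : D} (f : X ⟶ Y) (hf : f ∈ N.hom X Y) :
    algebraMap Λ K r • quot τ f hf = quot τ (r • f) (Submodule.smul_mem _ r hf) :=
  algebraMap_smul_cls r ⟨f, hf⟩

instance : MonoidalCategoryStruct (Subquotient τ) where
  tensorObj X Y := ⟨X.obj ⊗ Y.obj⟩
  tensorUnit := ⟨𝟙_ D⟩
  whiskerLeft Z _ _ f := whiskerLeft Z.obj f
  whiskerRight f Z := whiskerRight f Z.obj
  tensorHom f g := comp (whiskerRight f _) (whiskerLeft _ g)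
  associator X Y Z := quotIso τ (α_ X.obj Y.obj Z.obj) (N.associator_hom_mem _ _ _)
    (N.associator_inv_mem _ _ _)
  leftUnitor X := quotIso τ (λ_ X.obj) (N.leftUnitor_hom_mem _) (N.leftUnitor_inv_mem _)
  rightUnitor X := quotIso τ (ρ_ X.obj) (N.rightUnitor_hom_mem _) (N.rightUnitor_inv_mem _)

instance : MonoidalCategory (Subquotient τ) where
  tensorHom_def _ _ := rfl
  id_tensorHom_id X Y := congrArg (cls τ) (Subtype.ext (by
    simp; rfl))
  tensorHom_comp_tensorHom := by
    rintro _ _ _ _ _ _ ⟨f⟩ ⟨g⟩ ⟨h⟩ ⟨k⟩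
    refine congrArg (cls τ) (Subtype.ext ?_)
    simpa [MonoidalCategory.tensorHom_def] using
      tensorHom_comp_tensorHom f.1 g.1 h.1 k.1
  whiskerLeft_id X Y := congrArg (cls τ) (Subtype.ext (whiskerLeft_id X.obj Y.obj))
  id_whiskerRight X Y := congrArg (cls τ) (Subtype.ext (id_whiskerRight X.obj Y.obj))
  associator_naturality := by
    rintro _ _ _ _ _ _ ⟨f⟩ ⟨g⟩ ⟨h⟩
    refine congrArg (cls τ) (Subtype.ext ?_)
    have := associator_naturality f.1 g.1 h.1
    simp only [MonoidalCategory.tensorHom_def] at this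
    exact this
  leftUnitor_naturality := by
    rintro _ _ ⟨f⟩
    exact congrArg (cls τ) (Subtype.ext (leftUnitor_naturality f.1))
  rightUnitor_naturality := by
    rintro _ _ ⟨f⟩
    exact congrArg (cls τ) (Subtype.ext (rightUnitor_naturality f.1))
  pentagon W X Y Z := congrArg (cls τ) (Subtype.ext (pentagon W.obj X.obj Y.obj Z.obj))
  triangle X Y := congrArg (cls τ) (Subtype.ext (triangle X.obj Y.obj))

instance : SymmetricCategory (Subquotient τ) where
  braiding X Y := quotIso τ (β_ X.obj Y.obj) (N.braiding_hom_mem _ _) (by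
    rw [← SymmetricCategory.braiding_swap_eq_inv_braiding]
    exact N.braiding_hom_mem _ _)
  braiding_naturality_right := by
    rintro X _ _ ⟨f⟩
    exact congrArg (cls τ) (Subtype.ext (BraidedCategory.braiding_naturality_right X.obj f.1))
  braiding_naturality_left := by
    rintro _ _ ⟨f⟩ Z
    exact congrArg (cls τ) (Subtype.ext (BraidedCategory.braiding_naturality_left f.1 Z.obj))
  hexagon_forward X Y Z :=
    congrArg (cls τ) (Subtype.ext (BraidedCategory.hexagon_forward X.obj Y.obj Z.obj))
  hexagon_reverse X Y Z :=
    congrArg (cls τ) (Subtype.ext (BraidedCategory.hexagon_reverse X.obj Y.obj Z.obj))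
  symmetry X Y := congrArg (cls τ) (Subtype.ext (SymmetricCategory.symmetry X.obj Y.obj))

instance : MonoidalPreadditive (Subquotient τ) where
  whiskerLeft_zero := congrArg (cls τ) (Subtype.ext MonoidalPreadditive.whiskerLeft_zero)
  zero_whiskerRight := congrArg (cls τ) (Subtype.ext MonoidalPreadditive.zero_whiskerRight)
  whiskerLeft_add := by
    rintro _ _ _ ⟨f⟩ ⟨g⟩
    exact congrArg (cls τ) (Subtype.ext (MonoidalPreadditive.whiskerLeft_add f.1 g.1))
  add_whiskerRight := by
    rintro _ _ _ ⟨f⟩ ⟨g⟩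
    exact congrArg (cls τ) (Subtype.ext (MonoidalPreadditive.add_whiskerRight f.1 g.1))

instance : MonoidalLinear K (Subquotient τ) where
  whiskerLeft_smul := by
    rintro _ _ _ c ⟨f⟩
    obtain ⟨r, rfl⟩ := τ.surjective c
    refine (congrArg (whiskerLeft _ ·) (algebraMap_smul_cls r f)).trans
      (Eq.trans ?_ (algebraMap_smul_cls r _).symm)
    exact congrArg (cls τ) (Subtype.ext (MonoidalLinear.whiskerLeft_smul _ _ f.1))
  smul_whiskerRight := by
    rintro c _ _ ⟨f⟩ _
    obtain ⟨r, rfl⟩ := τ.surjective c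
    refine (congrArg (whiskerRight · _) (algebraMap_smul_cls r f)).trans
      (Eq.trans ?_ (algebraMap_smul_cls r _).symm)
    exact congrArg (cls τ) (Subtype.ext (MonoidalLinear.smul_whiskerRight _ f.1 _))

lemma unit_bijective :
    Function.Bijective (fun r : K => r • 𝟙 (𝟙_ (Subquotient τ))) := by
  constructor
  · intro r s h
    obtain ⟨r, rfl⟩ := τ.surjective r
    obtain ⟨s, rfl⟩ := τ.surjective s
    have h1 : cls τ (r • ⟨𝟙 (𝟙_ D), N.id_mem _⟩) = cls τ (s • ⟨𝟙 (𝟙_ D), N.id_mem _⟩) :=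
      (algebraMap_smul_cls r _).symm.trans (h.trans (algebraMap_smul_cls s _))
    -- The trivial context, with `U` the unit object, already detects a nonzero scalar.
    have h2 := cls_eq_cls.1 h1 (𝟙_ D) (λ_ _).inv (N.leftUnitor_inv_mem _) (λ_ _).hom
      (N.leftUnitor_hom_mem _)
    have h3 : (⟨(λ_ (𝟙_ D)).inv ≫ ((r • 𝟙 (𝟙_ D)) - s • 𝟙 (𝟙_ D)) ▷ (𝟙_ D) ≫ (λ_ _).hom,
        context_mem (sub_mem (Submodule.smul_mem _ _ (N.id_mem _))
          (Submodule.smul_mem _ _ (N.id_mem _)))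
        (N.leftUnitor_inv_mem _) (N.leftUnitor_hom_mem _)⟩ : N.hom _ _) =
        (r - s) • ⟨𝟙 (𝟙_ D), N.id_mem _⟩ := by
      ext
      simp [← sub_smul]
    have h4 := (congrArg τ.toFun h3).symm.trans h2
    rw [map_smul, τ.map_one, Algebra.smul_def, _root_.mul_one, map_sub] at h4
    exact sub_eq_zero.1 h4
  · rintro ⟨f⟩
    obtain ⟨r, hr⟩ := τ.exists_smul f.1 f.2
    exact ⟨algebraMap Λ K r, (algebraMap_smul_cls r _).trans (congrArg (cls τ) (Subtype.ext hr.symm))⟩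

end Subquotient
end MonoidalSubmodule

/-! ### Matrices indexed by states, on formal tensor powers -/

/-- A family of finite sets of states with rational weights, together with a jointly injective
family of specializations to `ℚ` of a ring of parameters. One of the parameters is attached to each
genus, and it is specialized to a power sum of the weights. -/
structure StateModel (Λ : Type*) [CommRing Λ] (I : Type v) where
  /-- The states. -/
  State : I → Type
  [fintype : ∀ i, Fintype (State i)]
  [decidableEq : ∀ i, DecidableEq (State i)]
  /-- The weights of the states. -/
  weight (i : I) : State i → ℚ
  weight_ne_zero (i : I) (x : State i) : weight i x ≠ 0
  /-- The specializations of the parameters. -/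
  param : I → Λ →+* ℚ
  /-- The parameter attached to the closed surface of given genus. -/
  surface : ℕ → Λ
  -- In `ℚ^S` each idempotent contributes its weight once for every handle, and the inverse weight
  -- for the counit: hence the exponent `n - 1`.
  param_surface (i : I) (n : ℕ) : param i (surface n) = ∑ x, weight i x ^ ((n : ℤ) - 1)
  eq_zero_of_param (r : Λ) : (∀ i, param i r = 0) → r = 0

attribute [instance] StateModel.fintype StateModel.decidableEq

/-- The formal tensor powers of a single object. -/
inductive TensorWord {Λ : Type*} [CommRing Λ] {I : Type v} (𝓢 : StateModel Λ I) : Type w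
  | unit
  | gen
  | tensor (X Y : TensorWord 𝓢)

namespace TensorWord

variable {Λ : Type*} [CommRing Λ] {I : Type v} {𝓢 : StateModel Λ I}

/-- The set of tensor factors. -/
@[reducible] def Pos : TensorWord 𝓢 → Type
  | unit => Empty
  | gen => Unit
  | tensor X Y => Pos X ⊕ Pos Y

instance fintypePos : ∀ X : TensorWord 𝓢, Fintype (Pos X)
  | unit => inferInstanceAs (Fintype Empty)
  | gen => inferInstanceAs (Fintype Unit)
  | tensor X Y =>
    letI := fintypePos X
    letI := fintypePos Y
    inferInstanceAs (Fintype (Pos X ⊕ Pos Y))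

instance decidableEqPos : ∀ X : TensorWord 𝓢, DecidableEq (Pos X)
  | unit => inferInstanceAs (DecidableEq Empty)
  | gen => inferInstanceAs (DecidableEq Unit)
  | tensor X Y =>
    letI := decidableEqPos X
    letI := decidableEqPos Y
    inferInstanceAs (DecidableEq (Pos X ⊕ Pos Y))

/-- Families of matrices indexed by the states of the tensor factors. -/
abbrev Mat (X Y : TensorWord 𝓢) : Type v :=
  ∀ i : I, (Pos X → 𝓢.State i) → (Pos Y → 𝓢.State i) → ℚ

/-- The matrix that identifies tensor factors along a map. -/
def pull {X Y : TensorWord 𝓢} (f : Pos X → Pos Y) : Mat X Y :=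
  fun _ s t => if s = t ∘ f then 1 else 0

instance : Category.{v} (TensorWord 𝓢) where
  Hom := Mat
  id X := pull id
  comp M N := fun i s u => ∑ t, M i s t * N i t u
  id_comp M := by
    funext i s t
    simp [pull]
  comp_id M := by
    funext i s t
    simp [pull]
  assoc M N P := by
    funext i s t
    simp only [Finset.sum_mul, Finset.mul_sum, _root_.mul_assoc]
    exact Finset.sum_comm

lemma comp_apply {X Y Z : TensorWord 𝓢} (M : X ⟶ Y) (N : Y ⟶ Z) (i s u) :
    (M ≫ N) i s u = ∑ t, M i s t * N i t u := rfl

/-- `pull` as a morphism. -/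
def pullHom {X Y : TensorWord 𝓢} (f : Pos X → Pos Y) : X ⟶ Y := pull f

lemma pullHom_apply {X Y : TensorWord 𝓢} (f : Pos X → Pos Y) (i s t) :
    (pullHom f : X ⟶ Y) i s t = if s = t ∘ f then 1 else 0 := rfl

lemma id_eq (X : TensorWord 𝓢) : 𝟙 X = pullHom id := rfl

@[ext] lemma hom_ext {X Y : TensorWord 𝓢} {M N : X ⟶ Y} (h : ∀ i s t, M i s t = N i s t) :
    M = N := by
  funext i s t; exact h i s t

lemma comp_pullHom {X Y Z : TensorWord 𝓢} (M : X ⟶ Y) (f : Pos Y → Pos Z) (i s t) :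
    (M ≫ pullHom f) i s t = M i s (t ∘ f) := by
  simp [comp_apply, pullHom_apply]

/-- All structure isomorphisms have the form `pullHom`, so the coherence axioms become equalities
between maps of tensor factors. -/
lemma pullHom_comp_pullHom {X Y Z : TensorWord 𝓢} (f : Pos X → Pos Y) (g : Pos Y → Pos Z) :
    pullHom f ≫ pullHom g = (pullHom (g ∘ f) : X ⟶ Z) := by
  ext i s t
  rw [comp_pullHom]
  rfl

lemma pullHom_equiv_comp {X Y Z : TensorWord 𝓢} (e : Pos X ≃ Pos Y) (M : Y ⟶ Z) (i s t) :
    (pullHom e ≫ M : X ⟶ Z) i s t = M i (s ∘ e.symm) t := by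
  have h (t' : Pos Y → 𝓢.State i) : s = t' ∘ e ↔ s ∘ e.symm = t' := by
    rw [Equiv.comp_symm_eq]
  simp [comp_apply, pullHom_apply, h]

/-- The isomorphism given by a bijection of tensor factors. -/
@[simps]
def pullIso {X Y : TensorWord 𝓢} (e : Pos X ≃ Pos Y) : X ≅ Y where
  hom := pullHom e
  inv := pullHom e.symm
  hom_inv_id := by rw [pullHom_comp_pullHom, e.symm_comp_self, id_eq]
  inv_hom_id := by rw [pullHom_comp_pullHom, e.self_comp_symm, id_eq]

instance : Preadditive (TensorWord 𝓢) where
  homGroup X Y := inferInstanceAs (AddCommGroup (Mat X Y))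
  add_comp _ _ _ M M' N := by
    funext i s t
    exact (Finset.sum_congr rfl fun _ _ => add_mul _ _ _).trans Finset.sum_add_distrib
  comp_add _ _ _ M N N' := by
    funext i s t
    exact (Finset.sum_congr rfl fun _ _ => mul_add _ _ _).trans Finset.sum_add_distrib

/-- A scalar acts on the `i`-th matrix through the `i`-th specialization, so that a closed surface,
whose value varies with `i`, is a single element of `Λ`. -/
instance (X Y : TensorWord 𝓢) : Module Λ (Mat X Y) where
  smul r M := fun i s t => 𝓢.param i r * M i s t
  one_smul M := by funext i s t; exact (congrArg (· * _) (map_one _)).trans (_root_.one_mul _)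
  mul_smul a b M := by
    funext i s t; exact (congrArg (· * _) (map_mul _ _ _)).trans (_root_.mul_assoc _ _ _)
  smul_zero a := by funext i s t; exact mul_zero _
  smul_add a M N := by funext i s t; exact mul_add _ _ _
  add_smul a b M := by
    funext i s t; exact (congrArg (· * _) (map_add _ _ _)).trans (add_mul _ _ _)
  zero_smul M := by funext i s t; exact (congrArg (· * _) (map_zero _)).trans (zero_mul _)

instance : Linear Λ (TensorWord 𝓢) where
  homModule X Y := inferInstanceAs (Module Λ (Mat X Y))
  smul_comp _ _ _ r M N := by
    funext i s t
    exact (Finset.sum_congr rfl fun _ _ => _root_.mul_assoc _ _ _).trans (Finset.mul_sum _ _ _).symm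
  comp_smul _ _ _ M r N := by
    funext i s t
    exact (Finset.sum_congr rfl fun _ _ => mul_left_comm _ _ _).trans (Finset.mul_sum _ _ _).symm

lemma smul_apply {X Y : TensorWord 𝓢} (r : Λ) (M : X ⟶ Y) (i s t) :
    (r • M) i s t = 𝓢.param i r * M i s t := rfl

/-- The Kronecker product. -/
def kron {X Y X' Y' : TensorWord 𝓢} (M : X ⟶ Y) (N : X' ⟶ Y') : tensor X X' ⟶ tensor Y Y' :=
  fun i s t => M i (s ∘ Sum.inl) (t ∘ Sum.inl) * N i (s ∘ Sum.inr) (t ∘ Sum.inr)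

instance : MonoidalCategoryStruct (TensorWord 𝓢) where
  tensorObj := tensor
  tensorUnit := unit
  tensorHom := kron
  whiskerLeft X _ _ M := kron (𝟙 X) M
  whiskerRight M X := kron M (𝟙 X)
  associator X Y Z := pullIso (X := tensor (tensor X Y) Z) (Y := tensor X (tensor Y Z))
    (Equiv.sumAssoc (Pos X) (Pos Y) (Pos Z))
  leftUnitor X := pullIso (X := tensor unit X) (Equiv.emptySum Empty (Pos X))
  rightUnitor X := pullIso (X := tensor X unit) (Equiv.sumEmpty (Pos X) Empty)

instance : IsEmpty (Pos (𝟙_ (TensorWord 𝓢))) := inferInstanceAs (IsEmpty Empty)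

lemma associator_hom (X Y Z : TensorWord 𝓢) : (α_ X Y Z).hom =
    pullHom (X := (X ⊗ Y) ⊗ Z) (Y := X ⊗ (Y ⊗ Z))
      (Equiv.sumAssoc (Pos X) (Pos Y) (Pos Z)) := rfl

lemma associator_inv (X Y Z : TensorWord 𝓢) : (α_ X Y Z).inv =
    pullHom (Y := (X ⊗ Y) ⊗ Z) (X := X ⊗ (Y ⊗ Z))
      (Equiv.sumAssoc (Pos X) (Pos Y) (Pos Z)).symm := rfl

lemma leftUnitor_hom (X : TensorWord 𝓢) : (λ_ X).hom =
    pullHom (X := 𝟙_ _ ⊗ X) (Equiv.emptySum Empty (Pos X)) := rfl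

lemma leftUnitor_inv (X : TensorWord 𝓢) : (λ_ X).inv =
    pullHom (Y := 𝟙_ _ ⊗ X) (Equiv.emptySum Empty (Pos X)).symm := rfl

lemma rightUnitor_hom (X : TensorWord 𝓢) : (ρ_ X).hom =
    pullHom (X := X ⊗ 𝟙_ _) (Equiv.sumEmpty (Pos X) Empty) := rfl

lemma rightUnitor_inv (X : TensorWord 𝓢) : (ρ_ X).inv =
    pullHom (Y := X ⊗ 𝟙_ _) (Equiv.sumEmpty (Pos X) Empty).symm := rfl

lemma tensorHom_apply {X Y X' Y' : TensorWord 𝓢} (M : X ⟶ Y) (N : X' ⟶ Y') (i s t) :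
    (M ⊗ₘ N) i s t = M i (s ∘ Sum.inl) (t ∘ Sum.inl) * N i (s ∘ Sum.inr) (t ∘ Sum.inr) := rfl

lemma sum_sumElim {A B S : Type} [Fintype A] [DecidableEq A] [Fintype B] [DecidableEq B]
    [Fintype S] (F : (A ⊕ B → S) → ℚ) :
    ∑ t, F t = ∑ t₁ : A → S, ∑ t₂ : B → S, F (Sum.elim t₁ t₂) := by
  rw [← Fintype.sum_prod_type']
  exact Fintype.sum_equiv (Equiv.sumArrowEquivProdArrow _ _ _) _ _ fun t =>
    congrArg F (Sum.elim_comp_inl_inr t).symm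

lemma eq_comp_sumMap_iff {A B A' B' S : Type} {f : A → B} {g : A' → B'} {s : A ⊕ A' → S}
    {t : B ⊕ B' → S} : s = t ∘ Sum.map f g ↔
      (s ∘ Sum.inl = (t ∘ Sum.inl) ∘ f ∧ s ∘ Sum.inr = (t ∘ Sum.inr) ∘ g) := by
  constructor
  · rintro rfl; exact ⟨rfl, rfl⟩
  · rintro ⟨h₁, h₂⟩
    funext x
    rcases x with x | x
    · exact congrFun h₁ x
    · exact congrFun h₂ x

lemma sum_tensor {X Y : TensorWord 𝓢} {i : I} (F : (Pos (X ⊗ Y) → 𝓢.State i) → ℚ) :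
    ∑ t, F t = ∑ t₁ : Pos X → 𝓢.State i, ∑ t₂ : Pos Y → 𝓢.State i, F (Sum.elim t₁ t₂) :=
  sum_sumElim F

lemma pullHom_tensorHom_pullHom {X Y X' Y' : TensorWord 𝓢} (f : Pos X → Pos Y)
    (g : Pos X' → Pos Y') :
    (pullHom f ⊗ₘ pullHom g : X ⊗ X' ⟶ Y ⊗ Y') = pullHom (Sum.map f g) := by
  ext i s t
  have h : s = t ∘ Sum.map f g ↔
      (s ∘ Sum.inl = (t ∘ Sum.inl) ∘ f ∧ s ∘ Sum.inr = (t ∘ Sum.inr) ∘ g) :=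
    eq_comp_sumMap_iff
  simp only [tensorHom_apply, pullHom_apply, h, ite_and]
  split_ifs <;> simp

lemma tensorHom_comp {X₁ Y₁ Z₁ X₂ Y₂ Z₂ : TensorWord 𝓢} (f₁ : X₁ ⟶ Y₁) (f₂ : X₂ ⟶ Y₂)
    (g₁ : Y₁ ⟶ Z₁) (g₂ : Y₂ ⟶ Z₂) :
    (f₁ ⊗ₘ f₂) ≫ (g₁ ⊗ₘ g₂) = (f₁ ≫ g₁) ⊗ₘ (f₂ ≫ g₂) := by
  ext i s t
  rw [comp_apply, sum_tensor, tensorHom_apply, comp_apply, comp_apply, Finset.sum_mul_sum]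
  refine Finset.sum_congr rfl fun _ _ => Finset.sum_congr rfl fun _ _ => ?_
  exact mul_mul_mul_comm _ _ _ _

instance : MonoidalCategory (TensorWord 𝓢) :=
  MonoidalCategory.ofTensorHom
    (id_tensorHom_id := fun X Y => by
      rw [id_eq, id_eq, pullHom_tensorHom_pullHom, Sum.map_id_id]; rfl)
    (id_tensorHom := fun _ _ _ _ => rfl)
    (tensorHom_id := fun _ _ => rfl)
    (tensorHom_comp_tensorHom := tensorHom_comp)
    (associator_naturality := fun f₁ f₂ f₃ => by
      ext i s t
      rw [associator_hom, associator_hom, comp_pullHom, pullHom_equiv_comp]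
      exact _root_.mul_assoc _ _ _)
    (leftUnitor_naturality := fun f => by
      ext i s t
      rw [leftUnitor_hom, leftUnitor_hom, comp_pullHom, pullHom_equiv_comp]
      rw [tensorHom_apply, id_eq, pullHom_apply, if_pos (Subsingleton.elim _ _), _root_.one_mul]
      rfl)
    (rightUnitor_naturality := fun f => by
      ext i s t
      rw [rightUnitor_hom, rightUnitor_hom, comp_pullHom, pullHom_equiv_comp]
      rw [tensorHom_apply, id_eq, pullHom_apply, if_pos (Subsingleton.elim _ _), _root_.mul_one]
      rfl)
    (pentagon := fun W X Y Z => by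
      simp only [associator_hom, id_eq, pullHom_tensorHom_pullHom, pullHom_comp_pullHom]
      congr 1
      funext x
      rcases x with ((x | x) | x) | x <;> rfl)
    (triangle := fun X Y => by
      simp only [associator_hom, leftUnitor_hom, rightUnitor_hom, id_eq, pullHom_tensorHom_pullHom,
        pullHom_comp_pullHom]
      congr 1
      funext x
      rcases x with (x | x) | x
      · rfl
      · exact x.elim
      · rfl)

lemma whiskerRight_eq {X Y : TensorWord 𝓢} (M : X ⟶ Y) (Z : TensorWord 𝓢) :
    M ▷ Z = M ⊗ₘ pullHom id := rfl

lemma whiskerLeft_eq {X Y : TensorWord 𝓢} (M : X ⟶ Y) (Z : TensorWord 𝓢) :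
    Z ◁ M = pullHom id ⊗ₘ M := rfl

/-- The braiding. -/
def braid (X Y : TensorWord 𝓢) : X ⊗ Y ≅ Y ⊗ X :=
  pullIso (X := X ⊗ Y) (Y := Y ⊗ X) (Equiv.sumComm (Pos X) (Pos Y))

lemma braid_hom (X Y : TensorWord 𝓢) : (braid X Y).hom =
    pullHom (X := X ⊗ Y) (Y := Y ⊗ X) (Equiv.sumComm (Pos X) (Pos Y)) := rfl

instance : SymmetricCategory (TensorWord 𝓢) where
  braiding := braid
  braiding_naturality_right X _ _ f := by
    ext i s t
    rw [braid_hom, braid_hom, comp_pullHom, pullHom_equiv_comp]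
    exact _root_.mul_comm _ _
  braiding_naturality_left f Z := by
    ext i s t
    rw [braid_hom, braid_hom, comp_pullHom, pullHom_equiv_comp]
    exact _root_.mul_comm _ _
  hexagon_forward X Y Z := by
    simp only [associator_hom, braid_hom, whiskerLeft_eq, whiskerRight_eq,
      pullHom_tensorHom_pullHom, pullHom_comp_pullHom]
    congr 1
    funext x
    rcases x with (x | x) | x <;> rfl
  hexagon_reverse X Y Z := by
    simp only [associator_inv, braid_hom, whiskerLeft_eq, whiskerRight_eq,
      pullHom_tensorHom_pullHom, pullHom_comp_pullHom]
    congr 1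
    funext x
    rcases x with x | x | x <;> rfl
  symmetry X Y := by
    simp only [braid_hom, pullHom_comp_pullHom, id_eq]
    congr 1
    funext x
    rcases x with x | x <;> rfl

lemma braiding_hom (X Y : TensorWord 𝓢) : (β_ X Y).hom =
    pullHom (X := X ⊗ Y) (Y := Y ⊗ X) (Equiv.sumComm (Pos X) (Pos Y)) := rfl

instance : MonoidalPreadditive (TensorWord 𝓢) where
  whiskerLeft_zero := by
    intros
    ext
    exact mul_zero _
  zero_whiskerRight := by
    intros
    ext
    exact zero_mul _
  whiskerLeft_add _ _ := by
    ext
    exact mul_add _ _ _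
  add_whiskerRight _ _ := by
    ext
    exact add_mul _ _ _

instance : MonoidalLinear Λ (TensorWord 𝓢) where
  whiskerLeft_smul _ _ _ _ _ := by
    ext
    exact mul_left_comm _ _ _
  smul_whiskerRight _ _ _ _ _ := by
    ext
    exact _root_.mul_assoc _ _ _

end TensorWord

/-! ### Coequalizers of finite sets and sums over fibers -/

section Coequalizer

variable {A Y : Type*}

/-- The coequalizer of two maps of types. -/
def Coeq (f g : Y → A) : Type _ := Quot fun x x' => ∃ y, x = f y ∧ x' = g y

namespace Coeq

variable {f g : Y → A}

/-- The projection. -/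
def mk (f g : Y → A) (x : A) : Coeq f g := Quot.mk _ x

lemma mk_eq (y : Y) : mk f g (f y) = mk f g (g y) := Quot.sound ⟨y, rfl, rfl⟩

/-- The universal property. -/
def lift {S : Type*} (h : A → S) (hfg : h ∘ f = h ∘ g) : Coeq f g → S :=
  Quot.lift h (by rintro _ _ ⟨y, rfl, rfl⟩; exact congrFun hfg y)

lemma lift_mk {S : Type*} (h : A → S) (hfg : h ∘ f = h ∘ g) (x : A) :
    lift h hfg (mk f g x) = h x := rfl

lemma hom_ext {S : Type*} {h h' : Coeq f g → S} (H : h ∘ mk f g = h' ∘ mk f g) : h = h' := by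
  funext x
  induction x using Quot.ind
  exact congrFun H _

noncomputable instance [Finite A] : Fintype (Coeq f g) :=
  haveI : Finite (Coeq f g) := inferInstanceAs (Finite (Quot _))
  Fintype.ofFinite _

noncomputable instance : DecidableEq (Coeq f g) := Classical.decEq _

/-- Regard `A` as vertices and `Y` as edges joining `f y` to `g y`: a connected graph has at most
one vertex more than it has edges. The proof bounds the rank and the kernel of the coboundary map.
-/
lemma card_fiber_le [Fintype A] [Fintype Y] (p : Coeq f g) :
    Fintype.card {x // mk f g x = p} ≤ Fintype.card {y // mk f g (f y) = p} + 1 := by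
  classical
  let L : ({x // mk f g x = p} → ℚ) →ₗ[ℚ] ({y // mk f g (f y) = p} → ℚ) :=
    { toFun := fun h y => h ⟨f y, y.2⟩ - h ⟨g y, (mk_eq _).symm.trans y.2⟩
      map_add' := fun h h' => by funext y; simp; ring
      map_smul' := fun c h => by funext y; simp; ring }
  have hker : LinearMap.ker L ≤ ℚ ∙ (fun _ => 1 : {x // mk f g x = p} → ℚ) := by
    intro h hh
    -- Extended by zero, a function killed by the coboundary descends to the coequalizer, so it is
    -- constant on the fiber over `p`.
    let F : A → ℚ := fun x => if hx : mk f g x = p then h ⟨x, hx⟩ else 0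
    have hF : F ∘ f = F ∘ g := by
      funext y
      by_cases hy : mk f g (f y) = p
      · have hy' : mk f g (g y) = p := (mk_eq _).symm.trans hy
        have := congrFun (LinearMap.mem_ker.1 hh) ⟨y, hy⟩
        simp only [Function.comp_apply, F, dif_pos hy, dif_pos hy']
        exact sub_eq_zero.1 this
      · have hy' : ¬ mk f g (g y) = p := fun h => hy ((mk_eq _).trans h)
        simp only [Function.comp_apply, F, dif_neg hy, dif_neg hy']
    refine Submodule.mem_span_singleton.2 ⟨lift F hF p, ?_⟩
    funext x
    obtain ⟨x, rfl⟩ := x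
    simp [lift_mk, F]
  have h1 := L.finrank_range_add_finrank_ker
  have h2 := Submodule.finrank_mono hker
  have h3 := finrank_span_le_card (R := ℚ) ({fun _ => 1} : Set ({x // mk f g x = p} → ℚ))
  have h4 := Submodule.finrank_le (LinearMap.range L)
  simp only [Module.finrank_fintype_fun_eq_card, Set.toFinset_singleton,
    Finset.card_singleton] at h1 h3 h4
  omega

end Coeq

end Coequalizer

/-- The pushforward of a function with finite domain. -/
def pushSum {V P : Type*} [Fintype V] [DecidableEq P] (κ : V → P) (e : V → ℤ) (p : P) : ℤ :=
  ∑ v with κ v = p, e v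

lemma pushSum_add {V P : Type*} [Fintype V] [DecidableEq P] (κ : V → P) (e e' : V → ℤ) :
    pushSum κ (e + e') = pushSum κ e + pushSum κ e' := by
  funext p
  exact Finset.sum_add_distrib

lemma pushSum_pushSum {V P Q : Type*} [Fintype V] [Fintype P] [DecidableEq P] [DecidableEq Q]
    (κ : V → P) (κ' : P → Q) (e : V → ℤ) :
    pushSum κ' (pushSum κ e) = pushSum (κ' ∘ κ) e := by
  funext p
  have h (x : P) : (if κ' x = p then ∑ v, if κ v = x then e v else 0 else 0) =
      ∑ v, if κ v = x then (if κ' (κ v) = p then e v else 0) else 0 := by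
    split_ifs with hx
    · exact Finset.sum_congr rfl fun v _ => if_ctx_congr Iff.rfl (fun hv => by simp [hv, hx])
        fun _ => rfl
    · refine (Finset.sum_eq_zero fun v _ => ?_).symm
      split_ifs with h1 h2
      · exact (hx (h1 ▸ h2)).elim
      · rfl
      · rfl
  simp only [pushSum, Finset.sum_filter, Function.comp_apply, h]
  rw [Finset.sum_comm]
  simp

lemma pushSum_sumElim_zero {V C P : Type*} [Fintype V] [Fintype C] [DecidableEq P]
    (κ : V ⊕ C → P) (e : V → ℤ) :
    pushSum κ (Sum.elim e 0) = pushSum (κ ∘ Sum.inl) e := by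
  funext p
  simp [pushSum, Finset.sum_filter]

lemma pushSum_single {V P : Type*} [Fintype V] [DecidableEq V] [DecidableEq P]
    (κ : V → P) (x : V) (n : ℤ) : pushSum κ (Pi.single x n) = Pi.single (κ x) n := by
  funext p
  simp [pushSum, Pi.single_apply, eq_comm]

lemma zpow_sum_eq_prod {V : Type*} (s : Finset V) (e : V → ℤ) {a : ℚ} (ha : a ≠ 0) :
    a ^ ∑ v ∈ s, e v = ∏ v ∈ s, a ^ e v := by
  classical
  induction s using Finset.induction_on with
  | empty => simp
  | insert v s hv ih => rw [Finset.sum_insert hv, Finset.prod_insert hv, zpow_add₀ ha, ih]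

lemma prod_zpow_pushSum {V P : Type*} [Fintype V] [Fintype P] [DecidableEq P] (κ : V → P)
    (e : V → ℤ) (a : P → ℚ) (ha : ∀ p, a p ≠ 0) :
    ∏ p, a p ^ pushSum κ e p = ∏ v, a (κ v) ^ e v := by
  rw [← Finset.prod_fiberwise (s := Finset.univ) (g := κ)]
  refine Finset.prod_congr rfl fun p _ => ?_
  rw [pushSum, zpow_sum_eq_prod _ _ (ha p)]
  refine Finset.prod_congr rfl fun v hv => ?_
  rw [(Finset.mem_filter.1 hv).2]

/-! ### State sums of cobordisms, with their tensor products and gluing -/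

namespace TensorWord

variable {Λ : Type*} [CommRing Λ] {I : Type v} {𝓢 : StateModel Λ I}

/-- The state sum of a cobordism whose set of components is `V`, whose incoming and outgoing
boundary circles are distributed over the components by `q` and `r`, and which has exponents `e`:
the exponent of a component is its genus plus the number of its outgoing circles minus one. -/
def cob {X Y : TensorWord 𝓢} (V : Type) [Fintype V] [DecidableEq V] (q : Pos X → V)
    (r : Pos Y → V) (e : V → ℤ) : X ⟶ Y :=
  fun i s t => ∑ v : V → 𝓢.State i,
    if s = v ∘ q ∧ t = v ∘ r then ∏ x, 𝓢.weight i (v x) ^ e x else 0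

/-- The genera of all components are nonnegative. -/
def Admissible {Y : TensorWord 𝓢} {V : Type} [DecidableEq V] (r : Pos Y → V) (e : V → ℤ) : Prop :=
  ∀ x, (Fintype.card {y // r y = x} : ℤ) ≤ e x + 1

section
variable {X Y Z : TensorWord 𝓢} {V W : Type} [Fintype V] [DecidableEq V] [Fintype W]
  [DecidableEq W]

lemma cob_apply (q : Pos X → V) (r : Pos Y → V) (e : V → ℤ) (i s t) :
    (cob V q r e : X ⟶ Y) i s t = ∑ v : V → 𝓢.State i,
      if s = v ∘ q ∧ t = v ∘ r then ∏ x, 𝓢.weight i (v x) ^ e x else 0 := rfl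

/-- The components are of genus zero with exactly one outgoing circle each, so their exponents are
zero. Identities, braidings, the unit and the multiplication are all of this kind. -/
lemma pullHom_eq_cob (f : Pos X → Pos Y) :
    (pullHom f : X ⟶ Y) = cob (Pos Y) f id 0 := by
  ext i s t
  rw [cob_apply, pullHom_apply, Finset.sum_eq_single t]
  · simp
  · intro v _ hv
    rw [if_neg fun h => hv h.2.symm]
  · simp

lemma admissible_id : Admissible (id : Pos Y → Pos Y) 0 := fun x => by
  simp

lemma cob_tensor {X' Y' : TensorWord 𝓢} (q : Pos X → V) (r : Pos Y → V) (e : V → ℤ)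
    (q' : Pos X' → W) (r' : Pos Y' → W) (e' : W → ℤ) :
    (cob V q r e ⊗ₘ cob W q' r' e' : X ⊗ X' ⟶ Y ⊗ Y') =
      cob (V ⊕ W) (Sum.map q q') (Sum.map r r') (Sum.elim e e') := by
  ext i s t
  rw [tensorHom_apply, cob_apply, cob_apply, cob_apply, Finset.sum_mul_sum, sum_sumElim]
  refine Finset.sum_congr rfl fun a _ => Finset.sum_congr rfl fun b _ => ?_
  have h₁ : s = Sum.elim a b ∘ Sum.map q q' ↔ (s ∘ Sum.inl = a ∘ q ∧ s ∘ Sum.inr = b ∘ q') :=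
    eq_comp_sumMap_iff
  have h₂ : t = Sum.elim a b ∘ Sum.map r r' ↔ (t ∘ Sum.inl = a ∘ r ∧ t ∘ Sum.inr = b ∘ r') :=
    eq_comp_sumMap_iff
  rw [ite_zero_mul_ite_zero, Fintype.prod_sum_type]
  refine if_congr ?_ rfl rfl
  rw [h₁, h₂]
  tauto

omit [Fintype V] [Fintype W] in
lemma Admissible.tensor {Y' : TensorWord 𝓢} {r : Pos Y → V} {e : V → ℤ}
    {r' : Pos Y' → W} {e' : W → ℤ} (h : Admissible r e) (h' : Admissible r' e') :
    Admissible (Y := Y ⊗ Y') (Sum.map r r') (Sum.elim e e') := by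
  rintro (x | x)
  · refine le_trans ?_ (h x)
    refine Nat.cast_le.2 (Fintype.card_le_of_surjective
      (fun y : {y // r y = x} => ⟨Sum.inl y.1, congrArg Sum.inl y.2⟩) ?_)
    rintro ⟨y | y, hy⟩
    · exact ⟨⟨y, Sum.inl_injective hy⟩, rfl⟩
    · exact (Sum.inr_ne_inl hy).elim
  · refine le_trans ?_ (h' x)
    refine Nat.cast_le.2 (Fintype.card_le_of_surjective
      (fun y : {y // r' y = x} => ⟨Sum.inr y.1, congrArg Sum.inr y.2⟩) ?_)
    rintro ⟨y | y, hy⟩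
    · exact (Sum.inl_ne_inr hy).elim
    · exact ⟨⟨y, Sum.inr_injective hy⟩, rfl⟩

/-- The set of components of a composition. -/
abbrev Glue (r : Pos Y → V) (q' : Pos Y → W) : Type :=
  Coeq (Sum.inl ∘ r : Pos Y → V ⊕ W) (Sum.inr ∘ q')

/-- The map from components of the first piece to components of the composition. -/
def glueLeft (r : Pos Y → V) (q' : Pos Y → W) (x : V) : Glue r q' := Coeq.mk _ _ (Sum.inl x)

/-- The map from components of the second piece to components of the composition. -/
def glueRight (r : Pos Y → V) (q' : Pos Y → W) (x : W) : Glue r q' := Coeq.mk _ _ (Sum.inr x)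

/-- Universal property of the coequalizer: a state of the glued surface is a pair of states that
agree on the circles in the middle. -/
lemma sum_glue {r : Pos Y → V} {q' : Pos Y → W} {S : Type} [Fintype S] [DecidableEq S]
    (G : (V → S) → (W → S) → ℚ) :
    ∑ p : Glue r q' → S, G (p ∘ glueLeft r q') (p ∘ glueRight r q') =
      ∑ a : V → S, ∑ b : W → S, if a ∘ r = b ∘ q' then G a b else 0 := by
  rw [← Fintype.sum_prod_type', ← Finset.sum_filter]
  refine Finset.sum_bij (fun p _ => (p ∘ glueLeft r q', p ∘ glueRight r q')) ?_ ?_ ?_ ?_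
  · intro p _
    refine Finset.mem_filter.2 ⟨Finset.mem_univ _, ?_⟩
    funext y
    exact congrArg p (Coeq.mk_eq y)
  · intro p _ p' _ h
    refine Coeq.hom_ext ?_
    funext x
    rcases x with x | x
    · exact congrFun (congrArg Prod.fst h) x
    · exact congrFun (congrArg Prod.snd h) x
  · rintro ⟨a, b⟩ h
    have h := (Finset.mem_filter.1 h).2
    exact ⟨Coeq.lift (Sum.elim a b) h, Finset.mem_univ _, rfl⟩
  · intros; rfl

/-- The weights of pieces glued into one component multiply, so their exponents add. This is why
components carry exponents rather than genera, which are not additive under gluing. -/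
lemma cob_comp (q : Pos X → V) (r : Pos Y → V) (e : V → ℤ)
    (q' : Pos Y → W) (r' : Pos Z → W) (e' : W → ℤ) :
    (cob V q r e : X ⟶ Y) ≫ (cob W q' r' e' : Y ⟶ Z) =
      cob (Glue r q') (glueLeft r q' ∘ q) (glueRight r q' ∘ r')
        (pushSum (glueLeft r q') e + pushSum (glueRight r q') e') := by
  ext i s u
  have h1 (p : Glue r q' → 𝓢.State i) : ∏ x, 𝓢.weight i (p x) ^
      (pushSum (glueLeft r q') e + pushSum (glueRight r q') e') x =
      (∏ x, 𝓢.weight i ((p ∘ glueLeft r q') x) ^ e x) *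
        ∏ x, 𝓢.weight i ((p ∘ glueRight r q') x) ^ e' x := by
    simp only [Pi.add_apply, zpow_add₀ (𝓢.weight_ne_zero i _), Finset.prod_mul_distrib]
    rw [prod_zpow_pushSum _ _ (fun x => 𝓢.weight i (p x)) fun _ => 𝓢.weight_ne_zero i _,
      prod_zpow_pushSum _ _ (fun x => 𝓢.weight i (p x)) fun _ => 𝓢.weight_ne_zero i _]
    rfl
  rw [cob_apply]
  simp only [h1]
  refine Eq.trans ?_ (sum_glue fun a b => if s = a ∘ q ∧ u = b ∘ r' then
    (∏ x, 𝓢.weight i (a x) ^ e x) * ∏ x, 𝓢.weight i (b x) ^ e' x else 0).symm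
  simp only [comp_apply, cob_apply, Finset.sum_mul_sum]
  rw [Finset.sum_comm]
  refine Finset.sum_congr rfl fun a _ => ?_
  rw [Finset.sum_comm]
  refine Finset.sum_congr rfl fun b _ => ?_
  rw [Finset.sum_eq_single (a ∘ r)]
  · by_cases h₁ : s = a ∘ q <;> by_cases h₂ : u = b ∘ r' <;> by_cases h₃ : a ∘ r = b ∘ q' <;>
      simp [h₁, h₂, h₃]
  · intro t _ ht
    simp [ht]
  · simp

lemma card_filter_eq_sum_fiber {P : Type} [DecidableEq P] (r : Pos Y → V) (κ : V → P) (p : P) :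
    Fintype.card {y // κ (r y) = p} = ∑ v with κ v = p, Fintype.card {y // r y = v} := by
  simp only [Fintype.card_subtype]
  rw [Finset.card_eq_sum_card_fiberwise (f := r) (t := {v | κ v = p})]
  · refine Finset.sum_congr rfl fun v hv => ?_
    congr 1
    ext y
    simp only [Finset.mem_filter, Finset.mem_univ, true_and] at hv ⊢
    constructor
    · exact fun h => h.2
    · rintro rfl; exact ⟨hv, rfl⟩
  · intro y hy
    simpa using hy

lemma Admissible.sum_le {P : Type} [DecidableEq P] {r : Pos Y → V} {e : V → ℤ}
    (h : Admissible r e) (κ : V → P) (p : P) :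
    (Fintype.card {y // κ (r y) = p} : ℤ) ≤ pushSum κ e p + Fintype.card {v // κ v = p} := by
  rw [card_filter_eq_sum_fiber, Fintype.card_subtype, pushSum, Nat.cast_sum]
  refine (Finset.sum_le_sum fun v _ => h v).trans ?_
  simp [Finset.sum_add_distrib]

/-- Genera stay nonnegative: a glued component made of `m` pieces is connected, so at least `m - 1`
circles were glued in it (`Coeq.card_fiber_le`), and this compensates the `-1` in the exponent of
each piece. -/
lemma Admissible.glue {r : Pos Y → V} {e : V → ℤ} (h : Admissible r e)
    {q' : Pos Y → W} {r' : Pos Z → W} {e' : W → ℤ} (h' : Admissible r' e') :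
    Admissible (glueRight r q' ∘ r')
      (pushSum (glueLeft r q') e + pushSum (glueRight r q') e') := by
  intro p
  have h1 := h.sum_le (glueLeft r q') p
  have h2 := h'.sum_le (glueRight r q') p
  have h3 := Coeq.card_fiber_le p
  have h4 : Fintype.card {x // Coeq.mk (Sum.inl ∘ r : Pos Y → V ⊕ W) (Sum.inr ∘ q') x = p} =
      Fintype.card {x // glueLeft r q' x = p} + Fintype.card {x // glueRight r q' x = p} := by
    rw [← Fintype.card_sum]
    exact Fintype.card_congr (Equiv.subtypeSum)
  rw [h4] at h3
  have h5 : ((Fintype.card {x // glueLeft r q' x = p} : ℤ) +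
      Fintype.card {x // glueRight r q' x = p}) ≤
      Fintype.card {y // glueLeft r q' (r y) = p} + 1 := by exact_mod_cast h3
  simp only [Pi.add_apply, Function.comp_apply]
  linarith

end

end TensorWord

/-! ### The subcategory spanned by cobordisms, and its closed evaluations -/

namespace TensorWord

variable {Λ : Type*} [CommRing Λ] {I : Type v} {𝓢 : StateModel Λ I}

/-- The state sums of admissible cobordisms. -/
def IsCob {X Y : TensorWord 𝓢} (M : X ⟶ Y) : Prop :=
  ∃ (V : Type) (_ : Fintype V) (_ : DecidableEq V) (q : Pos X → V) (r : Pos Y → V) (e : V → ℤ),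
    Admissible r e ∧ M = cob V q r e

lemma isCob_pullHom {X Y : TensorWord 𝓢} (f : Pos X → Pos Y) : IsCob (pullHom f : X ⟶ Y) :=
  ⟨Pos Y, inferInstance, inferInstance, f, id, 0, admissible_id, pullHom_eq_cob f⟩

lemma IsCob.comp {X Y Z : TensorWord 𝓢} {M : X ⟶ Y} {N : Y ⟶ Z} (hM : IsCob M) (hN : IsCob N) :
    IsCob (M ≫ N) := by
  obtain ⟨V, _, _, q, r, e, h, rfl⟩ := hM
  obtain ⟨W, _, _, q', r', e', h', rfl⟩ := hN
  exact ⟨_, inferInstance, inferInstance, _, _, _, h.glue h', cob_comp q r e q' r' e'⟩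

lemma IsCob.tensor {X Y X' Y' : TensorWord 𝓢} {M : X ⟶ Y} {N : X' ⟶ Y'} (hM : IsCob M)
    (hN : IsCob N) : IsCob (M ⊗ₘ N) := by
  obtain ⟨V, _, _, q, r, e, h, rfl⟩ := hM
  obtain ⟨W, _, _, q', r', e', h', rfl⟩ := hN
  exact ⟨_, inferInstance, inferInstance, _, _, _, h.tensor h', cob_tensor q r e q' r' e'⟩

/-- The subcategory of linear combinations of cobordisms. -/
def cobordisms (𝓢 : StateModel Λ I) : MonoidalSubmodule Λ (TensorWord 𝓢) where
  hom X Y := Submodule.span Λ {M | IsCob M}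
  id_mem X := Submodule.subset_span (isCob_pullHom _)
  comp_mem {X Y Z f g} hf hg := by
    induction hf using Submodule.span_induction with
    | mem f hf =>
      induction hg using Submodule.span_induction with
      | mem g hg => exact Submodule.subset_span (hf.comp hg)
      | zero => rw [Limits.comp_zero]; exact zero_mem _
      | add g g' _ _ h h' => rw [Preadditive.comp_add]; exact add_mem h h'
      | smul r g _ h => rw [Linear.comp_smul]; exact Submodule.smul_mem _ _ h
    | zero => rw [Limits.zero_comp]; exact zero_mem _
    | add f f' _ _ h h' => rw [Preadditive.add_comp]; exact add_mem h h'
    | smul r f _ h => rw [Linear.smul_comp]; exact Submodule.smul_mem _ _ h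
  whiskerLeft_mem X {Y Z f} hf := by
    induction hf using Submodule.span_induction with
    | mem f hf => exact Submodule.subset_span ((isCob_pullHom _).tensor hf)
    | zero => rw [MonoidalPreadditive.whiskerLeft_zero]; exact zero_mem _
    | add f f' _ _ h h' => rw [MonoidalPreadditive.whiskerLeft_add]; exact add_mem h h'
    | smul r f _ h => rw [MonoidalLinear.whiskerLeft_smul]; exact Submodule.smul_mem _ _ h
  whiskerRight_mem {Y Z f} X hf := by
    induction hf using Submodule.span_induction with
    | mem f hf => exact Submodule.subset_span (hf.tensor (isCob_pullHom _))
    | zero => rw [MonoidalPreadditive.zero_whiskerRight]; exact zero_mem _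
    | add f f' _ _ h h' => rw [MonoidalPreadditive.add_whiskerRight]; exact add_mem h h'
    | smul r f _ h => rw [MonoidalLinear.smul_whiskerRight]; exact Submodule.smul_mem _ _ h
  associator_hom_mem X Y Z := Submodule.subset_span (isCob_pullHom _)
  associator_inv_mem X Y Z := Submodule.subset_span (isCob_pullHom _)
  leftUnitor_hom_mem X := Submodule.subset_span (isCob_pullHom _)
  leftUnitor_inv_mem X := Submodule.subset_span (isCob_pullHom _)
  rightUnitor_hom_mem X := Submodule.subset_span (isCob_pullHom _)
  rightUnitor_inv_mem X := Submodule.subset_span (isCob_pullHom _)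
  braiding_hom_mem X Y := Submodule.subset_span (isCob_pullHom _)

lemma IsCob.mem {X Y : TensorWord 𝓢} {M : X ⟶ Y} (hM : IsCob M) : M ∈ (cobordisms 𝓢).hom X Y :=
  Submodule.subset_span hM

lemma mem_of_admissible {X Y : TensorWord 𝓢} {V : Type} [Fintype V] [DecidableEq V]
    (q : Pos X → V) {r : Pos Y → V} {e : V → ℤ} (h : Admissible r e) :
    (cob V q r e : X ⟶ Y) ∈ (cobordisms 𝓢).hom X Y :=
  IsCob.mem ⟨V, _, _, q, r, e, h, rfl⟩

lemma Admissible.nonneg {Y : TensorWord 𝓢} {V : Type} [DecidableEq V] {r : Pos Y → V} {e : V → ℤ}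
    (h : Admissible r e) (x : V) : 0 ≤ e x + 1 :=
  (Int.natCast_nonneg _).trans (h x)

section
variable {V C : Type} [Fintype V] [DecidableEq V] [Fintype C] [DecidableEq C]

lemma cob_equiv {X Y : TensorWord 𝓢} (φ : C ≃ V) (q : Pos X → C) (r : Pos Y → C) (e : V → ℤ) :
    (cob V (φ ∘ q) (φ ∘ r) e : X ⟶ Y) = cob C q r (e ∘ φ) := by
  ext i s t
  rw [cob_apply, cob_apply]
  refine Fintype.sum_equiv (φ.arrowCongr (Equiv.refl _)).symm _ _ fun v => ?_
  refine if_congr Iff.rfl ?_ rfl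
  exact (Equiv.prod_comp φ fun x => 𝓢.weight i (v x) ^ e x).symm

/-- Closed components are scalars. -/
lemma cob_sum_closed {X Y : TensorWord 𝓢} (q : Pos X → V) (r : Pos Y → V) (e : V ⊕ C → ℤ)
    (he : ∀ c, 0 ≤ e (Sum.inr c) + 1) :
    (cob (V ⊕ C) (Sum.inl ∘ q) (Sum.inl ∘ r) e : X ⟶ Y) =
      (∏ c, 𝓢.surface (e (Sum.inr c) + 1).toNat) • cob V q r (e ∘ Sum.inl) := by
  ext i s t
  rw [smul_apply, map_prod, cob_apply, cob_apply, sum_sumElim, Finset.mul_sum]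
  refine Finset.sum_congr rfl fun a _ => ?_
  have h (c : C) : 𝓢.param i (𝓢.surface (e (Sum.inr c) + 1).toNat) =
      ∑ x, 𝓢.weight i x ^ e (Sum.inr c) := by
    rw [𝓢.param_surface, Int.toNat_of_nonneg (he c), add_sub_cancel_right]
  simp only [h, Finset.prod_univ_sum, Fintype.piFinset_univ, Finset.sum_mul]
  refine Finset.sum_congr rfl fun b _ => ?_
  rw [mul_ite, mul_zero, Fintype.prod_sum_type, _root_.mul_comm]
  rfl

lemma cob_empty (q r) (e : Empty → ℤ) :
    (cob Empty q r e : 𝟙_ (TensorWord 𝓢) ⟶ 𝟙_ _) = 𝟙 _ := by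
  ext i s t
  rw [cob_apply, id_eq, pullHom_apply, if_pos (Subsingleton.elim _ _)]
  simp only [Finset.univ_unique, Finset.univ_eq_empty, Finset.prod_empty, Finset.sum_singleton]
  exact if_pos ⟨Subsingleton.elim _ _, Subsingleton.elim _ _⟩

/-- The case of `cob_sum_closed` in which no component meets the boundary. -/
lemma cob_closed (q r) (e : C → ℤ) (he : ∀ c, 0 ≤ e c + 1) :
    (cob C q r e : 𝟙_ (TensorWord 𝓢) ⟶ 𝟙_ _) =
      (∏ c, 𝓢.surface (e c + 1).toNat) • 𝟙 _ := by
  have h1 := cob_equiv (X := 𝟙_ (TensorWord 𝓢)) (Y := 𝟙_ _) (Equiv.emptySum Empty C)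
    (fun x => isEmptyElim x) (fun x => isEmptyElim x) e
  have h2 := cob_sum_closed (X := 𝟙_ (TensorWord 𝓢)) (Y := 𝟙_ _) (V := Empty)
    (fun x => isEmptyElim x) (fun x => isEmptyElim x) (e ∘ Equiv.emptySum Empty C) he
  rw [cob_empty] at h2
  refine Eq.trans ?_ (h1.trans (Eq.trans ?_ h2))
  · congr 1 <;> exact Subsingleton.elim _ _
  · congr 1 <;> exact Subsingleton.elim _ _

end

lemma exists_smul_of_mem (f : 𝟙_ (TensorWord 𝓢) ⟶ 𝟙_ _) (hf : f ∈ (cobordisms 𝓢).hom _ _) :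
    ∃ r : Λ, f = r • 𝟙 _ := by
  induction hf using Submodule.span_induction with
  | mem f hf =>
    obtain ⟨V, _, _, q, r, e, h, rfl⟩ := hf
    exact ⟨_, cob_closed q r e h.nonneg⟩
  | zero => exact ⟨0, (zero_smul _ _).symm⟩
  | add f f' _ _ h h' =>
    obtain ⟨r, rfl⟩ := h
    obtain ⟨r', rfl⟩ := h'
    exact ⟨r + r', (add_smul _ _ _).symm⟩
  | smul c f _ h =>
    obtain ⟨r, rfl⟩ := h
    exact ⟨c * r, (mul_smul _ _ _).symm⟩

lemma smul_id_injective (r : Λ) (h : r • 𝟙 (𝟙_ (TensorWord 𝓢)) = 0) : r = 0 := by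
  refine 𝓢.eq_zero_of_param r fun i => ?_
  have h1 := congrFun (congrFun (congrFun h i) isEmptyElim) isEmptyElim
  rw [smul_apply, id_eq, pullHom_apply, if_pos (Subsingleton.elim _ _), _root_.mul_one] at h1
  exact h1

/-- The endomorphisms of the unit object are the scalars. -/
noncomputable def unitEquiv (𝓢 : StateModel Λ I) :
    Λ ≃ₗ[Λ] (cobordisms 𝓢).hom (𝟙_ (TensorWord 𝓢)) (𝟙_ _) :=
  LinearEquiv.ofBijective (LinearMap.toSpanSingleton Λ _ ⟨𝟙 _, (cobordisms 𝓢).id_mem _⟩)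
    ⟨(injective_iff_map_eq_zero _).2 fun r hr => smul_id_injective r (congrArg Subtype.val hr),
      fun f => by
        obtain ⟨r, hr⟩ := exists_smul_of_mem f.1 f.2
        exact ⟨r, Subtype.ext hr.symm⟩⟩

variable {K : Type*} [Field K] [Algebra Λ K]

/-- The evaluation of closed cobordisms. -/
noncomputable def evaluation (𝓢 : StateModel Λ I)
    (hK : Function.Surjective (algebraMap Λ K)) : (cobordisms 𝓢).Evaluation K where
  toFun := Algebra.linearMap Λ K ∘ₗ (unitEquiv 𝓢).symm.toLinearMap
  map_one := by
    have : (⟨𝟙 _, (cobordisms 𝓢).id_mem _⟩ : (cobordisms 𝓢).hom (𝟙_ (TensorWord 𝓢)) (𝟙_ _)) =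
        unitEquiv 𝓢 1 := Subtype.ext (one_smul _ _).symm
    rw [this]
    simp
  exists_smul := exists_smul_of_mem
  surjective := hK

variable (K) in
/-- The endomorphisms of the unit object that evaluate to zero. -/
def nullUnit (𝓢 : StateModel Λ I) : Submodule Λ (𝟙_ (TensorWord 𝓢) ⟶ 𝟙_ _) :=
  Submodule.map (LinearMap.toSpanSingleton Λ _ (𝟙 _)) (RingHom.ker (algebraMap Λ K))

/-- Negligibility need only be tested on contexts that are cobordisms, because these span and
`nullUnit` is a submodule. -/
lemma mem_negligible_of_forall {𝓢 : StateModel Λ I} (τ : (cobordisms 𝓢).Evaluation K)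
    {X Y : TensorWord 𝓢} {f : X ⟶ Y} (hf : f ∈ (cobordisms 𝓢).hom X Y)
    (h : ∀ (U : TensorWord 𝓢) (a : 𝟙_ _ ⟶ X ⊗ U) (b : Y ⊗ U ⟶ 𝟙_ _), IsCob a → IsCob b →
      a ≫ f ▷ U ≫ b ∈ nullUnit K 𝓢) : ⟨f, hf⟩ ∈ τ.negligible X Y := by
  intro U a ha b hb
  have key : a ≫ f ▷ U ≫ b ∈ nullUnit K 𝓢 := by
    induction ha using Submodule.span_induction with
    | mem a ha =>
      induction hb using Submodule.span_induction with
      | mem b hb => exact h U a b ha hb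
      | zero => simp only [Limits.comp_zero]; exact zero_mem _
      | add b b' _ _ h h' => simp only [Preadditive.comp_add]; exact add_mem h h'
      | smul r b _ h => simp only [Linear.comp_smul]; exact Submodule.smul_mem _ _ h
    | zero => rw [Limits.zero_comp]; exact zero_mem _
    | add a a' _ _ h h' => rw [Preadditive.add_comp]; exact add_mem h h'
    | smul r a _ h => rw [Linear.smul_comp]; exact Submodule.smul_mem _ _ h
  obtain ⟨r, hr, hrf⟩ := key
  have h1 : (⟨a ≫ f ▷ U ≫ b, MonoidalSubmodule.context_mem hf ha hb⟩ :
      (cobordisms 𝓢).hom (𝟙_ _) (𝟙_ _)) = r • ⟨𝟙 _, (cobordisms 𝓢).id_mem _⟩ :=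
    Subtype.ext hrf.symm
  rw [h1, map_smul, Algebra.smul_def, show algebraMap Λ K r = 0 from hr, zero_mul]

section Context

variable {V : Type} [Fintype V] [DecidableEq V]

/-- Closing a cobordism adds up its exponents along a map of components. -/
lemma exists_context {X Y U : TensorWord 𝓢} {a : 𝟙_ _ ⟶ X ⊗ U} {b : Y ⊗ U ⟶ 𝟙_ _}
    (ha : IsCob a) (hb : IsCob b) (q : Pos X → V) (r : Pos Y → V) :
    ∃ (P : Type) (_ : Fintype P) (_ : DecidableEq P) (κ : V → P) (e₀ : P → ℤ),
      ∀ e, Admissible r e → (∀ p, 0 ≤ (e₀ + pushSum κ e) p + 1) ∧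
        a ≫ (cob V q r e : X ⟶ Y) ▷ U ≫ b =
          (∏ p, 𝓢.surface ((e₀ + pushSum κ e) p + 1).toNat) • 𝟙 _ := by
  obtain ⟨A, _, _, q₁, r₁, e₁, h₁, rfl⟩ := ha
  obtain ⟨B, _, _, q₂, r₂, e₂, h₂, rfl⟩ := hb
  -- The components of `a ≫ (cob ▷ U) ≫ b`, glued from the right. Neither they, nor `κ`, nor the
  -- contribution `e₀` of the context depends on `e`.
  refine ⟨Glue r₁ (glueLeft (Sum.map r id : Pos Y ⊕ Pos U → _) q₂ ∘ Sum.map q id), inferInstance,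
    inferInstance, glueRight r₁ (glueLeft (Sum.map r id : Pos Y ⊕ Pos U → _) q₂ ∘ Sum.map q id) ∘
      glueLeft (Sum.map r id : Pos Y ⊕ Pos U → _) q₂ ∘ Sum.inl, pushSum (glueLeft _ _) e₁ +
      pushSum (glueRight _ _) (pushSum (glueRight (Y := Y ⊗ U) _ _) e₂), fun e he => ?_⟩
  have hadm := h₁.glue (q' := glueLeft (Sum.map r id : Pos Y ⊕ Pos U → _) q₂ ∘ Sum.map q id)
    ((he.tensor (admissible_id (Y := U))).glue (q' := q₂) h₂)
  have hexp := pushSum_sumElim_zero (C := Pos U)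
    (glueRight r₁ (glueLeft (Sum.map r id : Pos Y ⊕ Pos U → _) q₂ ∘ Sum.map q id) ∘
      glueLeft (Sum.map r id : Pos Y ⊕ Pos U → _) q₂) e
  rw [← pushSum_pushSum] at hexp
  rw [pushSum_add, hexp] at hadm
  have hsum (x y z : Glue r₁ (glueLeft (Sum.map r id : Pos Y ⊕ Pos U → _) q₂ ∘ Sum.map q id) → ℤ) :
      x + (z + y) = x + y + z := by abel
  rw [hsum] at hadm
  refine ⟨hadm.nonneg, ?_⟩
  rw [whiskerRight_eq, pullHom_eq_cob, cob_tensor, cob_comp, cob_comp, cob_closed]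
  · rw [pushSum_add, hexp, hsum]; rfl
  · rw [pushSum_add, hexp, hsum]; exact hadm.nonneg

end Context

end TensorWord

/-! ### Local recurrence and finiteness of the Hom spaces -/

namespace MonoidalSubmodule.Subquotient

variable {Λ : Type*} [CommRing Λ] {D : Type*} [Category.{v} D] [Preadditive D] [Linear Λ D]
  [MonoidalCategory D] [SymmetricCategory D] {N : MonoidalSubmodule Λ D}
  {K : Type*} [Field K] [Algebra Λ K] [MonoidalPreadditive D] [MonoidalLinear Λ D]

lemma quot_congr {τ : N.Evaluation K} {X Y : D} {f g : X ⟶ Y} (h : f = g) (hf : f ∈ N.hom X Y)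
    (hg : g ∈ N.hom X Y) : quot τ f hf = quot τ g hg := congrArg (cls τ) (Subtype.ext h)

lemma quot_eq_sum {τ : N.Evaluation K} {X Y : D} {J : Type*} [Fintype J] {f : X ⟶ Y}
    (hf : f ∈ N.hom X Y) {g : J → (X ⟶ Y)} (hg : ∀ i, g i ∈ N.hom X Y) (c : J → Λ)
    (h : ⟨f - ∑ i, c i • g i, sub_mem hf (sum_mem fun i _ => Submodule.smul_mem _ _ (hg i))⟩ ∈
      τ.negligible X Y) :
    quot τ f hf = ∑ i, algebraMap Λ K (c i) • quot τ (g i) (hg i) := by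
  simp only [algebraMap_smul_quot]
  have h1 : (∑ i, quot τ (c i • g i) (Submodule.smul_mem _ _ (hg i))) =
      quot τ (∑ i, c i • g i) (sum_mem fun i _ => Submodule.smul_mem _ _ (hg i)) := by
    refine (map_sum (τ.negligible X Y).mkQ
      (fun i => (⟨c i • g i, Submodule.smul_mem _ _ (hg i)⟩ : N.hom X Y)) Finset.univ).symm.trans ?_
    refine congrArg (cls τ) (Subtype.ext ?_)
    simp
  rw [h1]
  exact cls_eq_cls.2 h

end MonoidalSubmodule.Subquotient

namespace TensorWord

open MonoidalSubmodule MonoidalSubmodule.Subquotient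

variable {Λ : Type*} [CommRing Λ] {I : Type v} {𝓢 : StateModel Λ I}
  {K : Type*} [Field K] [Algebra Λ K]

lemma Admissible.add {Y : TensorWord 𝓢} {V : Type} [DecidableEq V] {r : Pos Y → V} {e e' : V → ℤ}
    (h : Admissible r e) (h' : 0 ≤ e') : Admissible r (e + e') := fun x =>
  (h x).trans (by have := h' x; simp only [Pi.add_apply, Pi.zero_apply] at *; linarith)

lemma Admissible.add_single {Y : TensorWord 𝓢} {V : Type} [DecidableEq V] {r : Pos Y → V}
    {e : V → ℤ} (h : Admissible r e) (x : V) (n : ℕ) :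
    Admissible r (e + Pi.single x (n : ℤ)) :=
  h.add (Pi.single_nonneg.2 (Int.natCast_nonneg n))

variable {V : Type} [Fintype V] [DecidableEq V]

/-- A recurrence for the evaluations of closed surfaces holds locally on every cobordism. -/
lemma quot_cob_recurrence (τ : (cobordisms 𝓢).Evaluation K) {d : ℕ} {c : Fin d → Λ}
    (hc : ∀ n, algebraMap Λ K (𝓢.surface (n + d)) =
      ∑ i, algebraMap Λ K (c i) * algebraMap Λ K (𝓢.surface (n + i)))
    {X Y : TensorWord 𝓢} (q : Pos X → V) {r : Pos Y → V} {e : V → ℤ} (h : Admissible r e) (x : V) :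
    quot τ (cob V q r (e + Pi.single x (d : ℤ)) : X ⟶ Y)
        (mem_of_admissible q (h.add_single x d)) =
      ∑ i : Fin d, algebraMap Λ K (c i) •
        quot τ (cob V q r (e + Pi.single x ((i : ℕ) : ℤ)) : X ⟶ Y)
          (mem_of_admissible q (h.add_single x i)) := by
  refine quot_eq_sum _ (fun i : Fin d => mem_of_admissible q (h.add_single x i)) c
    (mem_negligible_of_forall τ _ fun U a b ha hb => ?_)
  obtain ⟨P, _, _, κ, e₀, H⟩ := exists_context ha hb q r
  -- Adding `n` handles on `x` raises the genus of the closed component containing `x` by `n` and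
  -- leaves the other factors unchanged.
  have key (n : ℕ) : a ≫ (cob V q r (e + Pi.single x (n : ℤ)) : X ⟶ Y) ▷ U ≫ b =
      (𝓢.surface (((e₀ + pushSum κ e) (κ x) + 1).toNat + n) *
        ∏ p ∈ Finset.univ.erase (κ x), 𝓢.surface ((e₀ + pushSum κ e) p + 1).toNat) • 𝟙 _ := by
    rw [(H _ (h.add_single x n)).2, ← Finset.mul_prod_erase _ _ (Finset.mem_univ (κ x)),
      pushSum_add, pushSum_single]
    congr 2
    -- The truncation `toNat` commutes with adding `n` because the genus is nonnegative before the
    -- handles are added.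
    · congr 1
      have := (H e h).1 (κ x)
      simp only [Pi.add_apply, Pi.single_eq_same] at this ⊢
      omega
    · refine Finset.prod_congr rfl fun p hp => ?_
      simp [Pi.single_eq_of_ne (Finset.ne_of_mem_erase hp)]
  have hlin : a ≫ (cob V q r (e + Pi.single x (d : ℤ)) - ∑ i : Fin d,
      c i • cob V q r (e + Pi.single x ((i : ℕ) : ℤ)) : X ⟶ Y) ▷ U ≫ b =
      a ≫ (cob V q r (e + Pi.single x (d : ℤ)) : X ⟶ Y) ▷ U ≫ b -
      ∑ i : Fin d, c i • (a ≫ (cob V q r (e + Pi.single x ((i : ℕ) : ℤ)) : X ⟶ Y) ▷ U ≫ b) := by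
    have h1 : (cob V q r (e + Pi.single x (d : ℤ)) - ∑ i : Fin d,
        c i • cob V q r (e + Pi.single x ((i : ℕ) : ℤ)) : X ⟶ Y) ▷ U =
        (cob V q r (e + Pi.single x (d : ℤ)) : X ⟶ Y) ▷ U - ∑ i : Fin d,
        c i • (cob V q r (e + Pi.single x ((i : ℕ) : ℤ)) : X ⟶ Y) ▷ U := by
      refine ((tensorRight U).map_sub).trans (congrArg (_ - ·) ?_)
      refine (sum_whiskerRight _ _ _).trans ?_
      simp only [MonoidalLinear.smul_whiskerRight]
    rw [h1, Preadditive.sub_comp, Preadditive.comp_sub, Preadditive.sum_comp, Preadditive.comp_sum]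
    simp only [Linear.smul_comp, Linear.comp_smul]
  rw [hlin]
  simp only [key, smul_smul]
  rw [← Finset.sum_smul, ← sub_smul]
  simp only [← _root_.mul_assoc]
  rw [← Finset.sum_mul, ← sub_mul]
  refine ⟨_, ?_, rfl⟩
  refine Ideal.mul_mem_right _ _ ?_
  simp [RingHom.mem_ker, hc]

/-- The least exponents that are admissible. -/
noncomputable def baseExponent {Y : TensorWord 𝓢} (r : Pos Y → V) (x : V) : ℤ :=
  (Nat.card {y // r y = x} : ℤ) - 1

omit [Fintype V] in
lemma admissible_baseExponent_add {Y : TensorWord 𝓢} (r : Pos Y → V) (g : V → ℕ) :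
    Admissible r (baseExponent r + fun x => (g x : ℤ)) := fun x => by
  simp only [baseExponent, Pi.add_apply, Nat.card_eq_fintype_card]
  linarith [Int.natCast_nonneg (g x)]

/-- Induction on the total genus: while some component carries at least `d` handles, the recurrence
replaces `d` of them by fewer. -/
lemma quot_cob_mem_span_of_recurrence (τ : (cobordisms 𝓢).Evaluation K) {d : ℕ} {c : Fin d → Λ}
    (hc : ∀ n, algebraMap Λ K (𝓢.surface (n + d)) =
      ∑ i, algebraMap Λ K (c i) * algebraMap Λ K (𝓢.surface (n + i)))
    {X Y : TensorWord 𝓢} (q : Pos X → V) (r : Pos Y → V) (g : V → ℕ) :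
    quot τ (cob V q r (baseExponent r + fun x => (g x : ℤ)) : X ⟶ Y)
        (mem_of_admissible q (admissible_baseExponent_add r g)) ∈
      Submodule.span K (Set.range fun g : V → Fin d =>
        quot τ (cob V q r (baseExponent r + fun x => ((g x : ℕ) : ℤ)) : X ⟶ Y)
        (mem_of_admissible q (admissible_baseExponent_add r fun x => g x))) := by
  induction hn : ∑ x, g x using Nat.strong_induction_on generalizing g with
  | _ n ih =>
  subst hn
  by_cases hg : ∀ x, g x < d
  · exact Submodule.subset_span ⟨fun x => ⟨g x, hg x⟩, rfl⟩
  · push Not at hg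
    obtain ⟨x, hx⟩ := hg
    obtain ⟨g, rfl⟩ : ∃ g' : V → ℕ, g = g' + Pi.single x d := by
      refine ⟨g - Pi.single x d, (tsub_add_cancel_of_le ?_).symm⟩
      intro y
      by_cases hy : y = x
      · subst hy; simpa using hx
      · simp [Pi.single_eq_of_ne hy]
    have hadd (n : ℕ) : (baseExponent r + fun y => ((g + Pi.single x n : V → ℕ) y : ℤ)) =
        (baseExponent r + fun y => (g y : ℤ)) + Pi.single x (n : ℤ) := by
      funext y
      by_cases hy : y = x
      · subst hy; simp [add_assoc]
      · simp [Pi.single_eq_of_ne hy]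
    have h := quot_cob_recurrence τ hc q (admissible_baseExponent_add r g) x
    simp only [← hadd] at h
    rw [h]
    refine Submodule.sum_mem _ fun i _ => Submodule.smul_mem _ _ (ih _ ?_ _ rfl)
    simp [Finset.sum_add_distrib]

/-- Every cobordism is a scalar multiple of one that has no closed components. -/
lemma exists_cob_eq_smul {X Y : TensorWord 𝓢} (q : Pos X → V) {r : Pos Y → V} {e : V → ℤ}
    (h : Admissible r e) : ∃ (s : Setoid (Pos X ⊕ Pos Y)) (R : Λ) (g : Quotient s → ℕ),
      ∀ (_ : Fintype (Quotient s)) (_ : DecidableEq (Quotient s)), (cob V q r e : X ⟶ Y) =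
        R • cob (Quotient s) (Quotient.mk s ∘ Sum.inl) (Quotient.mk s ∘ Sum.inr)
          (baseExponent (Quotient.mk s ∘ Sum.inr) + fun x => (g x : ℤ)) := by
  classical
  -- The components in the range of `F` are those that meet the boundary, and they amount to a
  -- partition of the boundary circles. The complement consists of closed components, which become
  -- the scalar.
  let F : Pos X ⊕ Pos Y → V := Sum.elim q r
  let φ : Quotient (Setoid.ker F) ⊕ ((Set.range F)ᶜ : Set V) ≃ V :=
    (Equiv.sumCongr (Setoid.quotientKerEquivRange F) (Equiv.refl _)).trans
      (Equiv.Set.sumCompl (Set.range F))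
  have hφ (z) : φ (Sum.inl (Quotient.mk (Setoid.ker F) z)) = F z := rfl
  have hpos (x : Quotient (Setoid.ker F)) :
      0 ≤ e (φ (Sum.inl x)) - baseExponent (Quotient.mk (Setoid.ker F) ∘ Sum.inr) x := by
    have h1 := h (φ (Sum.inl x))
    have h2 : Fintype.card {y // r y = φ (Sum.inl x)} =
        Fintype.card {y // (Quotient.mk (Setoid.ker F) ∘ Sum.inr) y = x} := by
      refine Fintype.card_congr (Equiv.subtypeEquivRight fun y => ?_)
      rw [show r y = φ (Sum.inl (Quotient.mk (Setoid.ker F) (Sum.inr y))) from rfl,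
        φ.injective.eq_iff, Sum.inl_injective.eq_iff]
      rfl
    rw [h2] at h1
    simp only [baseExponent, Nat.card_eq_fintype_card]
    linarith
  refine ⟨Setoid.ker F, ∏ c, 𝓢.surface (e (φ (Sum.inr c)) + 1).toNat,
    fun x => (e (φ (Sum.inl x)) - baseExponent (Quotient.mk (Setoid.ker F) ∘ Sum.inr) x).toNat,
    fun _ _ => ?_⟩
  have h1 := cob_equiv (X := X) (Y := Y) φ
    (Sum.inl ∘ Quotient.mk (Setoid.ker F) ∘ Sum.inl)
    (Sum.inl ∘ Quotient.mk (Setoid.ker F) ∘ Sum.inr) e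
  refine h1.trans ?_
  rw [cob_sum_closed _ _ _ fun c => h.nonneg _]
  congr 2
  funext x
  have := hpos x
  simp only [Function.comp_apply, Pi.add_apply]
  rw [Int.toNat_of_nonneg]
  · ring
  · exact this

/-- The generators are indexed by a partition of the boundary circles and a genus less than `d` on
each block; there are finitely many. -/
lemma finiteDimensional_hom (τ : (cobordisms 𝓢).Evaluation K) {d : ℕ} {c : Fin d → Λ}
    (hc : ∀ n, algebraMap Λ K (𝓢.surface (n + d)) =
      ∑ i, algebraMap Λ K (c i) * algebraMap Λ K (𝓢.surface (n + i)))
    (X Y : Subquotient τ) : FiniteDimensional K (X ⟶ Y) := by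
  classical
  obtain ⟨X⟩ := X
  obtain ⟨Y⟩ := Y
  let gens (σ : Σ s : Setoid (Pos X ⊕ Pos Y), Quotient s → Fin d) :
      (⟨X⟩ : Subquotient τ) ⟶ ⟨Y⟩ :=
    quot τ (cob (Quotient σ.1) (Quotient.mk _ ∘ Sum.inl) (Quotient.mk _ ∘ Sum.inr)
      (baseExponent _ + fun x => ((σ.2 x : ℕ) : ℤ)))
      (mem_of_admissible _ (admissible_baseExponent_add _ fun x => σ.2 x))
  have : Finite (Setoid (Pos X ⊕ Pos Y)) :=
    Finite.of_injective (fun s : Setoid (Pos X ⊕ Pos Y) => s.r) fun s t h => Setoid.ext fun a b => by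
      exact iff_of_eq (congrFun (congrFun h a) b)
  refine Module.finite_def.2 (Submodule.fg_def.2 ⟨Set.range gens, Set.finite_range _, ?_⟩)
  refine eq_top_iff.2 ?_
  rintro ⟨f, hf⟩ -
  change quot τ f hf ∈ _
  induction hf using Submodule.span_induction with
  | mem f hf =>
    obtain ⟨V, _, _, q, r, e, h, rfl⟩ := hf
    obtain ⟨s, R, g, hs⟩ := exists_cob_eq_smul q h
    have h1 := quot_cob_mem_span_of_recurrence τ hc (X := X) (Y := Y) (Quotient.mk s ∘ Sum.inl)
      (Quotient.mk s ∘ Sum.inr) g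
    have h2 : quot τ (cob V q r e : X ⟶ Y) (mem_of_admissible q h) = _ :=
      (congrArg (cls τ) (Subtype.ext (hs inferInstance inferInstance))).trans
        (algebraMap_smul_quot (τ := τ) R _
          (mem_of_admissible _ (admissible_baseExponent_add _ g))).symm
    refine h2 ▸ Submodule.smul_mem _ _ (Submodule.span_mono ?_ h1)
    rintro _ ⟨g', rfl⟩
    exact ⟨⟨s, g'⟩, rfl⟩
  | zero => exact zero_mem _
  | add f f' hf hf' h h' => exact add_mem h h'
  | smul r f hf h =>
    have := algebraMap_smul_quot (τ := τ) r f hf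
    exact this ▸ Submodule.smul_mem _ _ h

end TensorWord

/-! ### The circle as a commutative Frobenius algebra -/

namespace TensorWord

variable {Λ : Type*} [CommRing Λ] {I : Type v} {𝓢 : StateModel Λ I}

section
variable {X Y Z : TensorWord 𝓢} {V : Type} [Fintype V] [DecidableEq V]

lemma comp_cob_apply (M : X ⟶ Y) (q : Pos Y → V) (r : Pos Z → V) (e : V → ℤ) (i s u) :
    (M ≫ cob V q r e) i s u = ∑ v : V → 𝓢.State i,
      if u = v ∘ r then M i s (v ∘ q) * ∏ x, 𝓢.weight i (v x) ^ e x else 0 := by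
  simp only [comp_apply, cob_apply, Finset.mul_sum]
  rw [Finset.sum_comm]
  refine Finset.sum_congr rfl fun v _ => ?_
  rw [Finset.sum_eq_single (v ∘ q)]
  · by_cases h : u = v ∘ r <;> simp [h]
  · intro t _ ht
    simp [ht]
  · simp

lemma pullHom_comp_cob (f : Pos X → Pos Y) (q : Pos Y → V) (r : Pos Z → V) (e : V → ℤ) :
    (pullHom f ≫ cob V q r e : X ⟶ Z) = cob V (q ∘ f) r e := by
  ext i s u
  rw [comp_cob_apply, cob_apply]
  refine Finset.sum_congr rfl fun v _ => ?_
  have h' : s = (v ∘ q) ∘ f ↔ s = v ∘ q ∘ f := Iff.rfl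
  by_cases h : u = v ∘ r <;> simp [h, h', pullHom_apply]

end

variable (𝓢)

/-- The generating object. -/
abbrev circle : TensorWord 𝓢 := gen

/-- The connected cobordism of exponent `n`. -/
def connected (X Y : TensorWord 𝓢) (n : ℤ) : X ⟶ Y :=
  cob Unit (fun _ => ()) (fun _ => ()) fun _ => n

/-- The pair of pants. -/
def pants : circle 𝓢 ⊗ circle 𝓢 ⟶ circle 𝓢 := pullHom fun _ => ()

/-- The disk, as a unit. -/
def disk : 𝟙_ (TensorWord 𝓢) ⟶ circle 𝓢 := pullHom fun _ => ()

variable {𝓢}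

lemma pants_comp_connected (Y : TensorWord 𝓢) (n : ℤ) :
    pants 𝓢 ≫ connected 𝓢 _ Y n = connected 𝓢 _ Y n :=
  pullHom_comp_cob _ _ _ _

lemma disk_comp_connected (Y : TensorWord 𝓢) (n : ℤ) :
    disk 𝓢 ≫ connected 𝓢 _ Y n = connected 𝓢 _ Y n := by
  exact pullHom_comp_cob _ _ _ _

lemma admissible_connected {Y : TensorWord 𝓢} {n : ℤ} (h : (Fintype.card (Pos Y) : ℤ) ≤ n + 1) :
    Admissible (fun _ : Pos Y => ()) fun _ => n := fun _ =>
  le_trans (Nat.cast_le.2 (Fintype.card_subtype_le _)) h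

lemma connected_mem {X Y : TensorWord 𝓢} {n : ℤ} (h : (Fintype.card (Pos Y) : ℤ) ≤ n + 1) :
    connected 𝓢 X Y n ∈ (cobordisms 𝓢).hom X Y :=
  mem_of_admissible _ (admissible_connected h)

lemma disk_mem : disk 𝓢 ∈ (cobordisms 𝓢).hom _ _ := (isCob_pullHom _).mem

lemma pants_mem : pants 𝓢 ∈ (cobordisms 𝓢).hom _ _ := (isCob_pullHom _).mem

lemma disk_pants : disk 𝓢 ▷ circle 𝓢 ≫ pants 𝓢 = (λ_ (circle 𝓢)).hom := by
  rw [whiskerRight_eq, disk, pants, pullHom_tensorHom_pullHom, pullHom_comp_pullHom]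
  rfl

lemma pants_disk : circle 𝓢 ◁ disk 𝓢 ≫ pants 𝓢 = (ρ_ (circle 𝓢)).hom := by
  rw [whiskerLeft_eq, disk, pants, pullHom_tensorHom_pullHom, pullHom_comp_pullHom]
  rfl

lemma pants_pants : pants 𝓢 ▷ circle 𝓢 ≫ pants 𝓢 =
    (α_ _ _ _).hom ≫ circle 𝓢 ◁ pants 𝓢 ≫ pants 𝓢 := by
  rw [whiskerLeft_eq, whiskerRight_eq, pants, pullHom_tensorHom_pullHom, pullHom_tensorHom_pullHom,
    pullHom_comp_pullHom, pullHom_comp_pullHom, associator_hom, pullHom_comp_pullHom]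
  rfl

lemma braiding_pants : (β_ _ _).hom ≫ pants 𝓢 = pants 𝓢 := by
  rw [pants, braiding_hom, pullHom_comp_pullHom]

lemma forall_pos_tensor {X Y : TensorWord 𝓢} {p : Pos (X ⊗ Y) → Prop} :
    (∀ y, p y) ↔ (∀ y, p (Sum.inl y)) ∧ ∀ y, p (Sum.inr y) := Sum.forall

lemma sum_unit_fun {S : Type} [Fintype S] (F : (Unit → S) → ℚ) :
    ∑ v, F v = ∑ x, F fun _ => x :=
  Fintype.sum_equiv (Equiv.funUnique Unit S) _ _ fun _ => rfl

lemma connected_apply {X Y : TensorWord 𝓢} (n : ℤ) (i s t) :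
    connected 𝓢 X Y n i s t = ∑ x : 𝓢.State i,
      if (s = fun _ => x) ∧ (t = fun _ => x) then 𝓢.weight i x ^ n else 0 := by
  rw [connected, cob_apply, sum_unit_fun]
  simp [Function.comp_def]

lemma connected_circle_comp (X : TensorWord 𝓢) {Y : TensorWord 𝓢} (m n : ℤ) :
    connected 𝓢 X (circle 𝓢) m ≫ connected 𝓢 (circle 𝓢) Y n = connected 𝓢 X Y (m + n) := by
  ext i s u
  refine (comp_cob_apply _ _ _ _ _ _ _).trans ?_
  rw [connected_apply, sum_unit_fun]
  refine Finset.sum_congr rfl fun x _ => ?_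
  rw [connected, cob_apply, Finset.sum_eq_single fun _ => x]
  · by_cases h : u = fun _ => x <;> by_cases h' : s = fun _ => x <;>
      simp [h, h', Function.comp_def, zpow_add₀ (𝓢.weight_ne_zero i x)]
  · intro v _ hv
    rw [if_neg]
    rintro ⟨_, h⟩
    exact hv h.symm
  · simp

lemma connected_zero_circle : connected 𝓢 (circle 𝓢) (circle 𝓢) 0 = 𝟙 _ := by
  rw [id_eq, pullHom_eq_cob]
  rfl

lemma connected_closed (n : ℕ) :
    connected 𝓢 (𝟙_ _) (𝟙_ _) ((n : ℤ) - 1) = 𝓢.surface n • 𝟙 _ := by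
  rw [connected, cob_closed _ _ _ (by simp)]
  simp

lemma whiskerRight_connected (X Y : TensorWord 𝓢) (n : ℤ) :
    connected 𝓢 X Y n ▷ circle 𝓢 = cob (Unit ⊕ Unit) (Sum.map (fun _ => ()) id)
      (Sum.map (fun _ => ()) id) (Sum.elim (fun _ => n) 0) := by
  rw [whiskerRight_eq, pullHom_eq_cob]
  exact cob_tensor _ _ _ _ _ _

lemma whiskerLeft_connected (X Y : TensorWord 𝓢) (n : ℤ) :
    circle 𝓢 ◁ connected 𝓢 X Y n = cob (Unit ⊕ Unit) (Sum.map id (fun _ => ()))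
      (Sum.map id (fun _ => ())) (Sum.elim 0 (fun _ => n)) := by
  rw [whiskerLeft_eq, pullHom_eq_cob]
  exact cob_tensor _ _ _ _ _ _

/-- The computation behind both zigzag identities: the copairing has exponent `1`, the pairing has
exponent `-1`, and the weights cancel. -/
lemma sum_weight_mul_inv {i : I} (x z : 𝓢.State i) :
    ∑ a, ((if x = a then 1 else 0) * ∑ y, if a = y ∧ z = y then 𝓢.weight i y else 0) *
      (𝓢.weight i a)⁻¹ = if x = z then 1 else 0 := by
  simp only [ite_mul, _root_.one_mul, zero_mul]
  rw [Finset.sum_ite_eq, if_pos (Finset.mem_univ _)]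
  by_cases h : x = z
  · simp [h, 𝓢.weight_ne_zero]
  · rw [if_neg h, Finset.sum_eq_zero fun y _ => if_neg ?_, zero_mul]
    rintro ⟨h1, h2⟩
    exact h (h1.trans h2.symm)

lemma zigzag₁ : circle 𝓢 ◁ connected 𝓢 (𝟙_ _) (circle 𝓢 ⊗ circle 𝓢) 1 ≫ (α_ _ _ _).inv ≫
    connected 𝓢 (circle 𝓢 ⊗ circle 𝓢) (𝟙_ _) (-1) ▷ circle 𝓢 =
      (ρ_ (circle 𝓢)).hom ≫ (λ_ (circle 𝓢)).inv := by
  rw [rightUnitor_hom, leftUnitor_inv, pullHom_comp_pullHom, whiskerRight_connected,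
    associator_inv, pullHom_comp_cob]
  ext i s u
  obtain ⟨x, rfl⟩ : ∃ x, s = Sum.elim (fun _ => x) Empty.elim :=
    ⟨s (Sum.inl ()), by funext y; rcases y with y | y; rfl; exact y.elim⟩
  obtain ⟨z, rfl⟩ : ∃ z, u = Sum.elim Empty.elim (fun _ => z) :=
    ⟨u (Sum.inr ()), by funext y; rcases y with y | y; exact y.elim; rfl⟩
  rw [comp_cob_apply, sum_sumElim, sum_unit_fun]
  simp only [sum_unit_fun, whiskerLeft_eq, tensorHom_apply, pullHom_apply, connected_apply]
  simp only [funext_iff, forall_pos_tensor]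
  simp
  refine Eq.trans (Finset.sum_congr rfl fun a _ => congrArg (· * _) ?_) (sum_weight_mul_inv x z)
  exact congrArg₂ (· * ·) (if_congr ⟨fun h => h (), fun h _ => h⟩ rfl rfl) (Finset.sum_congr rfl fun y _ =>
    if_congr ⟨fun h => ⟨h.1 (), h.2 ()⟩, fun h => ⟨fun _ => h.1, fun _ => h.2⟩⟩ rfl rfl)

lemma zigzag₂ : connected 𝓢 (𝟙_ _) (circle 𝓢 ⊗ circle 𝓢) 1 ▷ circle 𝓢 ≫ (α_ _ _ _).hom ≫
    circle 𝓢 ◁ connected 𝓢 (circle 𝓢 ⊗ circle 𝓢) (𝟙_ _) (-1) =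
      (λ_ (circle 𝓢)).hom ≫ (ρ_ (circle 𝓢)).inv := by
  rw [leftUnitor_hom, rightUnitor_inv, pullHom_comp_pullHom, whiskerLeft_connected,
    associator_hom, pullHom_comp_cob]
  ext i s u
  obtain ⟨x, rfl⟩ : ∃ x, s = Sum.elim Empty.elim (fun _ => x) :=
    ⟨s (Sum.inr ()), by funext y; rcases y with y | y; exact y.elim; rfl⟩
  obtain ⟨z, rfl⟩ : ∃ z, u = Sum.elim (fun _ => z) Empty.elim :=
    ⟨u (Sum.inl ()), by funext y; rcases y with y | y; rfl; exact y.elim⟩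
  rw [comp_cob_apply, sum_sumElim, sum_unit_fun]
  simp only [sum_unit_fun, whiskerRight_eq, tensorHom_apply, pullHom_apply, connected_apply]
  simp only [funext_iff, forall_pos_tensor]
  simp
  refine Eq.trans (Finset.sum_congr rfl fun a _ => congrArg (· * _) ?_) (sum_weight_mul_inv x z)
  exact (_root_.mul_comm _ _).trans (congrArg₂ (· * ·)
    (if_congr ⟨fun h => h (), fun h _ => h⟩ rfl rfl) (Finset.sum_congr rfl fun y _ =>
    if_congr ⟨fun h => ⟨h.2 (), h.1 ()⟩, fun h => ⟨fun _ => h.2, fun _ => h.1⟩⟩ rfl rfl))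

/-- The handle is diagonal on the idempotents, with the weights as eigenvalues. -/
lemma comul_pants : (ρ_ (circle 𝓢)).inv ≫
    circle 𝓢 ◁ connected 𝓢 (𝟙_ _) (circle 𝓢 ⊗ circle 𝓢) 1 ≫ (α_ _ _ _).inv ≫
    pants 𝓢 ▷ circle 𝓢 ≫ pants 𝓢 = connected 𝓢 (circle 𝓢) (circle 𝓢) 1 := by
  rw [pants, whiskerRight_eq, pullHom_tensorHom_pullHom, pullHom_comp_pullHom, associator_inv,
    pullHom_comp_pullHom]
  ext i s u
  obtain ⟨x, rfl⟩ : ∃ x, s = fun _ => x := ⟨s (), rfl⟩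
  obtain ⟨z, rfl⟩ : ∃ z, u = fun _ => z := ⟨u (), rfl⟩
  rw [rightUnitor_inv, pullHom_equiv_comp, comp_pullHom, whiskerLeft_eq, tensorHom_apply,
    connected_apply, connected_apply, pullHom_apply]
  simp only [funext_iff]
  simp
  by_cases h : x = z
  · simp [h]
  · rw [if_neg h, Finset.sum_eq_zero fun y _ => if_neg ?_]
    rintro ⟨h1, h2⟩
    exact h (h1.trans h2.symm)

open MonoidalSubmodule MonoidalSubmodule.Subquotient

variable {K : Type*} [Field K] [Algebra Λ K] (τ : (cobordisms 𝓢).Evaluation K)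

/-- The circle as an object of the quotient category. -/
abbrev quotCircle : Subquotient τ := ⟨circle 𝓢⟩

instance : MonObj (quotCircle τ) where
  one := quot τ (disk 𝓢) disk_mem
  mul := quot τ (pants 𝓢) pants_mem
  one_mul := congrArg (cls τ) (Subtype.ext disk_pants)
  mul_one := congrArg (cls τ) (Subtype.ext pants_disk)
  mul_assoc := congrArg (cls τ) (Subtype.ext pants_pants)

instance : IsCommMonObj (quotCircle τ) where
  mul_comm := congrArg (cls τ) (Subtype.ext braiding_pants)

/-- The Frobenius structure of the circle. -/
def frobenius : FrobeniusStructure (quotCircle τ) where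
  counit := quot τ (connected 𝓢 (circle 𝓢) (𝟙_ _) (-1)) (connected_mem le_rfl)
  exactPairing :=
    { coevaluation' := quot τ (connected 𝓢 (𝟙_ _) (circle 𝓢 ⊗ circle 𝓢) 1) (connected_mem le_rfl)
      evaluation' := quot τ (connected 𝓢 (circle 𝓢 ⊗ circle 𝓢) (𝟙_ _) (-1)) (connected_mem le_rfl)
      coevaluation_evaluation' := congrArg (cls τ) (Subtype.ext zigzag₁)
      evaluation_coevaluation' := congrArg (cls τ) (Subtype.ext zigzag₂) }
  evaluation_eq := (congrArg (cls τ) (Subtype.ext (pants_comp_connected _ _))).symm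

lemma connected_circle_mem (n : ℕ) :
    connected 𝓢 (circle 𝓢) (circle 𝓢) n ∈ (cobordisms 𝓢).hom _ _ :=
  connected_mem (by
    change (1 : ℤ) ≤ _
    linarith [Int.natCast_nonneg n])

lemma frobenius_handle : (frobenius τ).handle =
    quot τ (connected 𝓢 (circle 𝓢) (circle 𝓢) 1) (connected_circle_mem 1) := by
  simp only [FrobeniusStructure.handle, FrobeniusStructure.comul, Category.assoc]
  exact quot_congr comul_pants _ _

lemma frobenius_handle_pow (n : ℕ) : ((frobenius τ).handle ^ n : End (quotCircle τ)) =
    quot τ (connected 𝓢 (circle 𝓢) (circle 𝓢) n) (connected_circle_mem n) := by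
  induction n with
  | zero =>
    rw [pow_zero]
    exact congrArg (cls τ) (Subtype.ext connected_zero_circle.symm)
  | succ n ih =>
    rw [pow_succ', ih, frobenius_handle, End.mul_def]
    refine (quot_comp _ _ _ _).trans (quot_congr ?_ _ _)
    rw [connected_circle_comp, Nat.cast_succ]

lemma frobenius_closed (n : ℕ) :
    (frobenius τ).closed n = algebraMap Λ K (𝓢.surface n) • 𝟙 (𝟙_ (Subquotient τ)) := by
  rw [FrobeniusStructure.closed, frobenius_handle_pow]
  refine Eq.trans (congrArg (cls τ) (Subtype.ext ?_))
    (algebraMap_smul_quot (τ := τ) (𝓢.surface n) _ ((cobordisms 𝓢).id_mem _)).symm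
  change disk 𝓢 ≫ connected 𝓢 _ _ _ ≫ connected 𝓢 _ _ _ = _
  rw [connected_circle_comp, disk_comp_connected, ← sub_eq_add_neg]
  exact connected_closed n

end TensorWord

/-! ### Algebraic independence of the power sums -/

lemma exists_sum_mul_zpow_eq (n : ℕ) (y : Fin n → ℚ) :
    ∃ m : Fin n → ℚ, ∀ g : Fin n, ∑ j : Fin n, m j * ((j : ℚ) + 1) ^ ((g : ℤ) - 1) = y g := by
  let a : Fin n → ℚ := fun j => (j : ℚ) + 1
  have ha (j) : a j ≠ 0 := by positivity
  have hdet : IsUnit (Matrix.vandermonde a).transpose.det := by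
    rw [Matrix.det_transpose, isUnit_iff_ne_zero, Matrix.det_vandermonde_ne_zero_iff]
    intro i j h
    simpa [a, Fin.ext_iff] using h
  -- The factor `a j` turns the exponents `g - 1` into the exponents `g` of the Vandermonde matrix,
  -- which is invertible as the weights are distinct.
  refine ⟨fun j => ((Matrix.vandermonde a).transpose⁻¹.mulVec y) j * a j, fun g => ?_⟩
  have h : (Matrix.vandermonde a).transpose.mulVec
      ((Matrix.vandermonde a).transpose⁻¹.mulVec y) = y := by
    rw [Matrix.mulVec_mulVec, Matrix.mul_nonsing_inv _ hdet, Matrix.one_mulVec]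
  rw [← congrFun h g, Matrix.mulVec, dotProduct]
  refine Finset.sum_congr rfl fun j _ => ?_
  rw [Matrix.transpose_apply, Matrix.vandermonde_apply, zpow_sub_one₀ (ha j), zpow_natCast]
  have := ha j
  change _ * a j * (a j ^ (g : ℕ) * (a j)⁻¹) = _
  field_simp

/-- A polynomial that vanishes on all power sums of weights `1, 2, 3, …`, taken with arbitrary
multiplicities, is zero. -/
lemma eq_zero_of_eval_powerSum {L : Type*} (r : MvPolynomial (L ⊕ ℕ) ℤ)
    (h : ∀ (n : ℕ) (m : Fin n → ℕ) (z : L → ℕ), MvPolynomial.eval₂Hom (Int.castRingHom ℚ)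
      (Sum.elim (fun c => (z c : ℚ))
        fun g : ℕ => ∑ j : Fin n, (m j : ℚ) * ((j : ℚ) + 1) ^ ((g : ℤ) - 1)) r = 0) : r = 0 := by
  classical
  -- With `n` beyond every genus that occurs in `r`, the weights `1, …, n` suffice.
  obtain ⟨n, hn⟩ : ∃ n, ∀ g, Sum.inr g ∈ r.vars → g < n := by
    refine ⟨r.vars.sup (Sum.elim (fun _ => 0) fun g => g) + 1, fun g hg => Nat.lt_succ_of_le ?_⟩
    exact Finset.le_sup (f := Sum.elim (fun _ => 0) fun g => g) hg
  -- Here the multiplicities become variables. Since `q` vanishes at all natural arguments it is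
  -- zero, which allows rational multiplicities.
  let q : MvPolynomial (L ⊕ Fin n) ℚ := MvPolynomial.eval₂Hom (Int.castRingHom _)
    (Sum.elim (fun c => MvPolynomial.X (Sum.inl c)) fun g : ℕ => ∑ j : Fin n,
      MvPolynomial.X (Sum.inr j) * MvPolynomial.C (((j : ℚ) + 1) ^ ((g : ℤ) - 1))) r
  have hq (y : L ⊕ Fin n → ℚ) : MvPolynomial.eval y q =
      MvPolynomial.eval₂Hom (Int.castRingHom ℚ) (Sum.elim (fun c => y (Sum.inl c))
        fun g : ℕ => ∑ j : Fin n, y (Sum.inr j) * ((j : ℚ) + 1) ^ ((g : ℤ) - 1)) r := by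
    simp only [q]
    rw [← RingHom.comp_apply]
    congr 1
    refine MvPolynomial.ringHom_ext (fun c => by simp) fun x => ?_
    rcases x with c | g <;> simp
  have hq0 : q = 0 := by
    refine MvPolynomial.funext_set (fun _ => Set.range ((↑) : ℕ → ℚ))
      (fun _ => Set.infinite_range_of_injective Nat.cast_injective) fun y hy => ?_
    choose z hz using fun x => hy x (Set.mem_univ x)
    obtain rfl : (fun x => (z x : ℚ)) = y := funext hz
    rw [hq, map_zero]
    exact h n (fun j => z (Sum.inr j)) fun c => z (Sum.inl c)
  refine MvPolynomial.map_injective (Int.castRingHom ℚ) Int.cast_injective ?_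
  rw [map_zero]
  refine MvPolynomial.funext fun y => ?_
  -- Rational multiplicities realize any prescribed values of the power sums in `r`, so `r` vanishes
  -- at every rational point.
  obtain ⟨m, hm⟩ := exists_sum_mul_zpow_eq n fun g => y (Sum.inr (g : ℕ))
  have h1 := hq (Sum.elim (fun c => y (Sum.inl c)) m)
  rw [hq0, map_zero] at h1
  rw [map_zero, h1, MvPolynomial.eval_map]
  refine MvPolynomial.eval₂Hom_congr' rfl (fun x hx _ => ?_) rfl
  rcases x with c | g
  · rfl
  · exact (hm ⟨g, hn g hx⟩).symm

/-- The universal family of weighted sets of states. -/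
noncomputable def powerSumModel (L : Type*) : StateModel (MvPolynomial (L ⊕ ℕ) ℤ)
    (ULift.{v} (Σ n : ℕ, (Fin n → ℕ) × (L → ℕ))) where
  State i := Σ j : Fin i.down.1, Fin (i.down.2.1 j)
  weight i x := (x.1 : ℚ) + 1
  weight_ne_zero i x := by positivity
  param i := MvPolynomial.eval₂Hom (Int.castRingHom ℚ) (Sum.elim (fun c => (i.down.2.2 c : ℚ))
    fun g : ℕ => ∑ x : (Σ j : Fin i.down.1, Fin (i.down.2.1 j)), ((x.1 : ℚ) + 1) ^ ((g : ℤ) - 1))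
  surface n := MvPolynomial.X (Sum.inr n)
  param_surface i n := by simp
  eq_zero_of_param r h := by
    refine eq_zero_of_eval_powerSum r fun n m z => ?_
    refine Eq.trans ?_ (h ⟨⟨n, m, z⟩⟩)
    congr 3
    funext g
    rw [Fintype.sum_sigma]
    simp

/-! ### The two implications -/

lemma isRecurrent_of_admitsFiniteRealization {k : Type u} [Field k] {α : ℕ → k}
    (h : AdmitsFiniteRealization.{u, w, v₁, u₁} α) : IsRecurrent α := by
  obtain ⟨R, hR⟩ := h
  let := R.symmetric
  let := R.monoidalPreadditive
  let := R.monoidalLinear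
  let := R.mon
  have : FiniteDimensional R.L (End R.A) := hR R.A R.A
  obtain ⟨p, hp, hx⟩ := Algebra.IsIntegral.isIntegral (R := R.L) R.frobenius.handle
  let ev (f : End R.A) : 𝟙_ R.C ⟶ 𝟙_ R.C := η[R.A] ≫ f ≫ R.frobenius.counit
  have hev (n : ℕ) : ∑ i ∈ Finset.range (p.natDegree + 1),
      p.coeff i * algebraMap k R.L (α (i + n)) = 0 := by
    apply R.unit_bijective.1
    have h1 : ∑ i ∈ Finset.range (p.natDegree + 1),
        p.coeff i • R.frobenius.handle ^ (i + n) = 0 := by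
      have h2 := congrArg (· * R.frobenius.handle ^ n) hx
      rw [← Polynomial.aeval_def, Polynomial.aeval_eq_sum_range] at h2
      simpa only [Finset.sum_mul, zero_mul, smul_mul_assoc, ← pow_add] using h2
    have h3 : ev (∑ i ∈ Finset.range (p.natDegree + 1),
        p.coeff i • R.frobenius.handle ^ (i + n)) = 0 := by
      rw [h1]
      exact (congrArg (_ ≫ ·) Limits.zero_comp).trans Limits.comp_zero
    have h4 : ev (∑ i ∈ Finset.range (p.natDegree + 1),
        p.coeff i • R.frobenius.handle ^ (i + n)) = ∑ i ∈ Finset.range (p.natDegree + 1),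
        p.coeff i • ev (R.frobenius.handle ^ (i + n)) := by
      simp only [ev]
      refine (congrArg (_ ≫ ·) (Preadditive.sum_comp _ _ _)).trans
        ((Preadditive.comp_sum _ _ _).trans (Finset.sum_congr rfl fun i _ => ?_))
      exact (congrArg (_ ≫ ·) (Linear.smul_comp _ _ _ _ _ _)).trans (Linear.comp_smul _ _ _ _ _ _)
    rw [h4] at h3
    simp only [zero_smul, Finset.sum_smul]
    refine Eq.trans (Finset.sum_congr rfl fun i _ => ?_) h3
    rw [mul_smul]
    exact congrArg _ (R.evaluation (i + n)).symm
  -- A `k`-linear retraction of `k → L`, applied to the relation over `L`. As `p` is monic, the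
  -- leading term survives unchanged.
  obtain ⟨θ, hθ⟩ := (Algebra.linearMap k R.L).exists_leftInverse_of_injective
    (LinearMap.ker_eq_bot.2 (algebraMap k R.L).injective)
  have hθ' (c : R.L) (a : k) : θ (c * algebraMap k R.L a) = θ c * a := by
    rw [_root_.mul_comm c, ← Algebra.smul_def, map_smul, smul_eq_mul, _root_.mul_comm]
  have hθ'' (a : k) : θ (algebraMap k R.L a) = a := LinearMap.congr_fun hθ a
  refine ⟨⟨p.natDegree, fun i => -θ (p.coeff i)⟩, 0, fun n => ?_⟩
  have h5 := congrArg θ (hev n)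
  rw [Finset.sum_range_succ, hp.coeff_natDegree, _root_.one_mul, map_add, map_sum, hθ'', map_zero] at h5
  simp only [hθ'] at h5
  rw [Finset.sum_range] at h5
  simp only [zero_add, neg_mul, Finset.sum_neg_distrib]
  rw [_root_.add_comm n, eq_neg_iff_add_eq_zero, ← h5, _root_.add_comm]
  simp only [_root_.add_comm n]

/-- Padding the coefficients with `N` zeros in front turns an eventual recurrence into one that
holds from the first term, at the cost of a larger order. -/
lemma IsRecurrent.exists_coeffs {k : Type*} [Field k] {α : ℕ → k} (h : IsRecurrent α) :
    ∃ (d : ℕ) (c : Fin d → k), ∀ n, α (n + d) = ∑ i, c i * α (n + i) := by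
  obtain ⟨E, N, hE⟩ := h
  refine ⟨N + E.order, Fin.append 0 E.coeffs, fun n => ?_⟩
  rw [Fin.sum_univ_add]
  have := hE n
  simp only [← add_assoc] at this
  simp [Fin.append_left, Fin.append_right, ← add_assoc, _root_.add_comm n N, this]

lemma admitsFiniteRealization_of_isRecurrent {k : Type u} [Field k] {α : ℕ → k}
    (h : IsRecurrent α) : AdmitsFiniteRealization.{u, max u w, max u w v₁, u₁} α := by
  obtain ⟨d, c, hc⟩ := h.exists_coeffs
  -- No proper extension is needed; the lift only adjusts the universe.
  let L := ULift.{w} k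
  -- The variables indexed by `L` go to themselves, which gives surjectivity; the variable of genus
  -- `n` goes to `α n`.
  let φ : MvPolynomial (L ⊕ ℕ) ℤ →+* L :=
    MvPolynomial.eval₂Hom (Int.castRingHom L) (Sum.elim id fun n => algebraMap k L (α n))
  let : Algebra (MvPolynomial (L ⊕ ℕ) ℤ) L := φ.toAlgebra
  have hφ (c : L) : algebraMap (MvPolynomial (L ⊕ ℕ) ℤ) L (MvPolynomial.X (Sum.inl c)) = c :=
    MvPolynomial.eval₂Hom_X' _ _ _
  let 𝓢 := powerSumModel.{v₁} L
  have h𝓢 (n : ℕ) : algebraMap (MvPolynomial (L ⊕ ℕ) ℤ) L (𝓢.surface n) = algebraMap k L (α n) :=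
    MvPolynomial.eval₂Hom_X' _ _ _
  let τ := TensorWord.evaluation 𝓢 (K := L) fun c => ⟨_, hφ c⟩
  refine ⟨{
    L := L
    C := MonoidalSubmodule.Subquotient τ
    symmetric := inferInstance
    monoidalPreadditive := inferInstance
    monoidalLinear := inferInstance
    unit_bijective := MonoidalSubmodule.Subquotient.unit_bijective
    A := TensorWord.quotCircle τ
    comm := inferInstance
    frobenius := TensorWord.frobenius τ
    evaluation := fun n => (TensorWord.frobenius_closed τ n).trans (by rw [h𝓢]) }, ?_⟩
  refine TensorWord.finiteDimensional_hom τ (d := d)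
    (c := fun i => MvPolynomial.X (Sum.inl (algebraMap k L (c i)))) fun n => ?_
  simp only [h𝓢, hφ, hc n, map_sum, map_mul]

theorem theorem3p1 {k : Type u} [Field k] (α : ℕ → k) :
    AdmitsFiniteRealization.{u, max u w, max u w v₁, u₁} α ↔ IsRecurrent α :=
  ⟨isRecurrent_of_admitsFiniteRealization, admitsFiniteRealization_of_isRecurrent.{u, w, v₁, u₁}⟩
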